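/- Let $F$ be a finite bipartite graph without isolated vertices. In the achievement game of $F$ on $K_{N,N}$, Alice and Bob alternately colour a not yet coloured edge of $K_{N,N}$, Alice (who moves first) in blue and Bob in red; the first player whose colour class contains a copy of $F$ (a not necessarily induced subgraph isomorphic to $F$) wins, and if all edges are coloured without this happening nobody wins. The bipartite achievement number $\operatorname{ba}(F)$ is the least $N$ for which Alice has a winning strategy in this game. Let $K_{1,m}\cup nK_2$ denote the disjoint union of a star with $m$ edges and a matching of $n$ edges. Theorem. 1) For every $n\ge 0$, $$\operatorname{ba}(K_{1,1}\cup nK_2)=\begin{cases} n+2, & n=1 \text{ or } n=2,\\ n+1, & n=0 \text{ or } n\ge 3.\end{cases}$$ 2) If $m\ge 2$, $n\ge 1$, and either $m\le 4$ or $n\ge m-2$, then $\operatorname{ba}(K_{1,m}\cup nK_2)=m+n$. 3) If $m\ge 5$ and $1\le n\le m-3$, then $\operatorname{ba}(K_{1,m}\cup nK_2)$ exists (Alice has a winning strategy for some $N$) and $m+n\le \operatorname{ba}(K_{1,m}\cup nK_2)\le 2m-2$. -/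

import Mathlib

open scoped SimpleGraph

/-- The disjoint union `K_{1,m} ∪ nK_2` of a star with `m` leaves and `n` independent edges. -/
def starMatching (m n : ℕ) :
    SimpleGraph ((Fin 1 ⊕ Fin m) ⊕ (Fin n × Fin 2)) :=
  completeBipartiteGraph (Fin 1) (Fin m) ⊕g
    { Adj := fun p q => p.1 = q.1 ∧ p.2 ≠ q.2
      symm := ⟨fun _ _ h => ⟨h.1.symm, h.2.symm⟩⟩
      loopless := ⟨fun _ h => h.2 rfl⟩ }

/-- The colour class `S` (a set of edges) contains a copy of `F`, not necessarily induced. -/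
def ContainsCopy {W V : Type*} (F : SimpleGraph W) (S : Set (Sym2 V)) : Prop :=
  F ⊑ SimpleGraph.fromEdgeSet S

/-- The edges of the board `G` that are still uncoloured when the edges in `B` are blue and those
in `R` are red. -/
def uncolored {V : Type*} (G : SimpleGraph V) (B R : Set (Sym2 V)) : Set (Sym2 V) :=
  G.edgeSet \ (B ∪ R)

/-- `AliceWins F G B R`: in the achievement game of `F` on the board `G`, Alice (blue) has a
winning strategy from the position with blue edges `B` and red edges `R`, Alice to move and nobody
having completed a copy of `F` yet. A derivation is a strategy tree:
* `finish`: Alice colours an uncoloured edge `e` and completes a blue `F`;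
* `round`: Alice colours an uncoloured edge `e`; the board is not exhausted (otherwise the game
  would end undecided), and no matter which uncoloured edge `f` Bob colours, he does not complete
  a red `F` and Alice has a winning strategy from the resulting position. -/
inductive AliceWins {W V : Type*} (F : SimpleGraph W) (G : SimpleGraph V) :
    Set (Sym2 V) → Set (Sym2 V) → Prop
  | finish (B R : Set (Sym2 V)) (e : Sym2 V) (he : e ∈ uncolored G B R)
      (hF : ContainsCopy F (insert e B)) : AliceWins F G B R
  | round (B R : Set (Sym2 V)) (e : Sym2 V) (he : e ∈ uncolored G B R)
      (hne : (uncolored G (insert e B) R).Nonempty)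
      (hBob : ∀ f ∈ uncolored G (insert e B) R, ¬ ContainsCopy F (insert f R))
      (hnext : ∀ f ∈ uncolored G (insert e B) R, AliceWins F G (insert e B) (insert f R)) :
      AliceWins F G B R

/-- Alice, moving first, has a winning strategy in the achievement game `(F, G, +)`. -/
def AliceHasWinningStrategy {W V : Type*} (F : SimpleGraph W) (G : SimpleGraph V) : Prop :=
  AliceWins F G ∅ ∅

/-- `ba(F) = k`: the number `k` is the least `N` such that Alice has a winning strategy in the
achievement game of `F` on `K_{N,N}`. In particular such an `N` exists. -/
def IsBipartiteAchievementNumber {W : Type*} (F : SimpleGraph W) (k : ℕ) : Prop :=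
  IsLeast {N : ℕ | AliceHasWinningStrategy F (completeBipartiteGraph (Fin N) (Fin N))} k

/-! Edges of $K_{N,N}$ are cells of an $N\times N$ grid, and the game is replayed on finite sets of
cells. The lower bound $m+n$ is immediate: the star leaves and one end of each matching edge occupy
$m+n$ vertices on one side (`Win.le_size`).

The upper bounds rest mostly on tempo. A copy has $m+n$ edges, so if every blue edge is useful, Bob
never has enough edges to finish first (`Win.step`). Alice can extend a matching without waste while
keeping at most one red cell in the block of unused rows and columns (`MatchState`). This settles
$K_{1,1}\cup nK_2$ on size $n+2$ and $K_{1,2}\cup nK_2$. For $m\ge 3$ and $N\ge 2m-2$ she completes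
the star in one row and then matches further columns, always treating the column with most red cells
(`win_star`, `win_saturate`).

A perfect matching on size $n+1$ with $n\ge 3$ takes extra moves. Bob must close the last cell,
after which exchanges along the almost perfect matching give a forced reply and then two
simultaneous threats (`win_of_doubleThreat`). The case analysis finds suitable exchange edges and
ensures that Bob cannot finish meanwhile.

Three small cases are checked by kernel computation with bit masks: the draws of the perfect
matching game on sizes 2 and 3, and one position of $K_{1,4}\cup K_2$ on size 5, to which that game
reduces by symmetry. -/

/-! ### The game on the cells of a grid -/

/-- The edge of `K_{N,N}` joining the left vertex `p.1` and the right vertex `p.2`. -/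
def cellEdge {N : ℕ} (p : Fin N × Fin N) : Sym2 (Fin N ⊕ Fin N) := s(Sum.inl p.1, Sum.inr p.2)

theorem cellEdge_injective {N : ℕ} : Function.Injective (cellEdge (N := N)) := by
  rintro ⟨a, b⟩ ⟨c, d⟩ h
  simpa [cellEdge] using h

/-- The achievement game with finite colour classes: `Win P B R` says that the player to move,
owning `B`, has a winning strategy against the owner of `R` when `P` is the goal. -/
inductive Win {ε : Type*} [DecidableEq ε] (P : Finset ε → Prop) : Finset ε → Finset ε → Prop
  | finish (B R : Finset ε) (e : ε) (heB : e ∉ B) (heR : e ∉ R) (hP : P (insert e B)) : Win P B R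
  | round (B R : Finset ε) (e : ε) (heB : e ∉ B) (heR : e ∉ R)
      (hne : ∃ f, f ∉ insert e B ∧ f ∉ R)
      (hBob : ∀ f, f ∉ insert e B → f ∉ R → ¬ P (insert f R))
      (hnext : ∀ f, f ∉ insert e B → f ∉ R → Win P (insert e B) (insert f R)) : Win P B R

/-- The goal of the game on `K_{N,N}` in terms of cells. -/
def CellGoal (m n N : ℕ) (S : Finset (Fin N × Fin N)) : Prop :=
  ContainsCopy (starMatching m n) (cellEdge '' (S : Set (Fin N × Fin N)))

theorem mem_uncolored_cellEdge {N : ℕ} {B R : Finset (Fin N × Fin N)} {e : Sym2 (Fin N ⊕ Fin N)} :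
    e ∈ uncolored (completeBipartiteGraph (Fin N) (Fin N)) (cellEdge '' (B : Set _))
      (cellEdge '' (R : Set _)) ↔ ∃ p, p ∉ B ∧ p ∉ R ∧ cellEdge p = e := by
  constructor
  · rintro ⟨he, hn⟩
    induction e using Sym2.ind with
    | _ u v =>
      simp only [SimpleGraph.mem_edgeSet, completeBipartiteGraph_adj] at he
      have key : ∀ p : Fin N × Fin N, cellEdge p = s(u, v) → p ∉ B ∧ p ∉ R := fun p hp =>
        ⟨fun h => hn (Or.inl ⟨p, h, hp⟩), fun h => hn (Or.inr ⟨p, h, hp⟩)⟩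
      rcases u with a | a <;> rcases v with b | b <;> simp at he
      · exact ⟨(a, b), (key (a, b) rfl).1, (key (a, b) rfl).2, rfl⟩
      · have h : cellEdge (b, a) = s(Sum.inr a, Sum.inl b) := Sym2.eq_swap
        exact ⟨(b, a), (key _ h).1, (key _ h).2, h⟩
  · rintro ⟨p, hB, hR, rfl⟩
    refine ⟨by simp [cellEdge], ?_⟩
    rintro (⟨q, hq, h⟩ | ⟨q, hq, h⟩)
    · exact hB (cellEdge_injective h ▸ hq)
    · exact hR (cellEdge_injective h ▸ hq)

theorem image_insert_cellEdge {N : ℕ} (B : Finset (Fin N × Fin N)) (p : Fin N × Fin N) :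
    insert (cellEdge p) (cellEdge '' (B : Set (Fin N × Fin N))) =
      cellEdge '' ((insert p B : Finset _) : Set (Fin N × Fin N)) := by
  rw [Finset.coe_insert, Set.image_insert_eq]

theorem Win.aliceWins {m n N : ℕ} {B R : Finset (Fin N × Fin N)} (h : Win (CellGoal m n N) B R) :
    AliceWins (starMatching m n) (completeBipartiteGraph (Fin N) (Fin N))
      (cellEdge '' (B : Set _)) (cellEdge '' (R : Set _)) := by
  induction h with
  | finish B R e heB heR hP =>
    refine .finish _ _ (cellEdge e) (mem_uncolored_cellEdge.2 ⟨e, heB, heR, rfl⟩) ?_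
    rw [image_insert_cellEdge]; exact hP
  | round B R e heB heR hne hBob hnext ih =>
    refine .round _ _ (cellEdge e) (mem_uncolored_cellEdge.2 ⟨e, heB, heR, rfl⟩) ?_ ?_ ?_
    · obtain ⟨f, h1, h2⟩ := hne
      rw [image_insert_cellEdge]
      exact ⟨cellEdge f, mem_uncolored_cellEdge.2 ⟨f, h1, h2, rfl⟩⟩
    · intro f hf
      rw [image_insert_cellEdge] at hf
      obtain ⟨p, h1, h2, rfl⟩ := mem_uncolored_cellEdge.1 hf
      rw [image_insert_cellEdge]
      exact hBob p h1 h2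
    · intro f hf
      rw [image_insert_cellEdge] at hf
      obtain ⟨p, h1, h2, rfl⟩ := mem_uncolored_cellEdge.1 hf
      rw [image_insert_cellEdge, image_insert_cellEdge]
      exact ih p h1 h2

/-- The colour classes are kept as variables with equations, since induction on the derivation needs
its indices to be free. -/
theorem AliceWins.win {m n N : ℕ} {B' R' : Set (Sym2 (Fin N ⊕ Fin N))}
    (h : AliceWins (starMatching m n) (completeBipartiteGraph (Fin N) (Fin N)) B' R') :
    ∀ B R : Finset (Fin N × Fin N), B' = cellEdge '' (B : Set _) → R' = cellEdge '' (R : Set _) →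
      Win (CellGoal m n N) B R := by
  induction h with
  | finish B' R' e he hF =>
    rintro B R rfl rfl
    obtain ⟨p, h1, h2, rfl⟩ := mem_uncolored_cellEdge.1 he
    refine .finish _ _ p h1 h2 ?_
    rw [image_insert_cellEdge] at hF; exact hF
  | round B' R' e he hne hBob hnext ih =>
    rintro B R rfl rfl
    obtain ⟨p, h1, h2, rfl⟩ := mem_uncolored_cellEdge.1 he
    rw [image_insert_cellEdge] at hne hBob ih
    refine .round _ _ p h1 h2 ?_ ?_ ?_
    · obtain ⟨f, hf⟩ := hne
      obtain ⟨q, h3, h4, -⟩ := mem_uncolored_cellEdge.1 hf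
      exact ⟨q, h3, h4⟩
    · intro f h3 h4
      have := hBob (cellEdge f) (mem_uncolored_cellEdge.2 ⟨f, h3, h4, rfl⟩)
      rwa [image_insert_cellEdge] at this
    · intro f h3 h4
      exact ih (cellEdge f) (mem_uncolored_cellEdge.2 ⟨f, h3, h4, rfl⟩) _ _ rfl
        (image_insert_cellEdge _ _)

theorem aliceHasWinningStrategy_iff {m n N : ℕ} :
    AliceHasWinningStrategy (starMatching m n) (completeBipartiteGraph (Fin N) (Fin N)) ↔
      Win (CellGoal m n N) ∅ ∅ := by
  refine ⟨fun h => AliceWins.win h ∅ ∅ (by simp) (by simp), fun h => ?_⟩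
  have := h.aliceWins
  simpa [AliceHasWinningStrategy] using this

/-- A bijection of cells preserving the goal transports whole strategy trees. It is used for
exchanging the two sides of the board and for permuting rows and columns. -/
theorem Win.map {ε : Type*} [DecidableEq ε] {P : Finset ε → Prop} (σ : ε ≃ ε)
    (hP : ∀ S, P (S.map σ.toEmbedding) ↔ P S) {B R : Finset ε} (h : Win P B R) :
    Win P (B.map σ.toEmbedding) (R.map σ.toEmbedding) := by
  induction h with
  | finish B R e heB heR hF =>
    refine .finish _ _ (σ e) (by simpa) (by simpa) ?_
    have := (hP _).2 hF
    rwa [Finset.map_insert] at this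
  | round B R e heB heR hne hBob hnext ih =>
    have mem : ∀ (f : ε) (S : Finset ε), f ∉ S.map σ.toEmbedding ↔ σ.symm f ∉ S := by
      intro f S; rw [Finset.mem_map_equiv]
    have ins : ∀ (f : ε) (S : Finset ε),
        insert f (S.map σ.toEmbedding) = (insert (σ.symm f) S).map σ.toEmbedding := by
      intro f S; simp [Finset.map_insert]
    refine .round _ _ (σ e) (by simpa) (by simpa) ?_ ?_ ?_
    · obtain ⟨f, h1, h2⟩ := hne
      exact ⟨σ f, by rw [ins, mem]; simpa using h1, by simpa using h2⟩
    · intro f h1 h2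
      rw [ins, mem] at h1; rw [mem] at h2
      rw [ins, hP]
      exact hBob _ (by simpa using h1) h2
    · intro f h1 h2
      rw [ins, mem] at h1; rw [mem] at h2
      rw [ins, ins]
      have := ih (σ.symm f) (by simpa using h1) h2
      simpa using this

/-! ### Copies of `K_{1,m} ∪ nK_2` in terms of cells -/

/-- A set of pairwise disjoint edges. -/
def IsMatch {N : ℕ} (M : Finset (Fin N × Fin N)) : Prop :=
  ∀ p ∈ M, ∀ q ∈ M, (p.1 = q.1 ∨ p.2 = q.2) → p = q

/-- `S` contains a copy of `K_{1,m} ∪ nK_2` whose star has its centre on the left. -/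
def HasLeft {N : ℕ} (m n : ℕ) (S : Finset (Fin N × Fin N)) : Prop :=
  ∃ (c : Fin N) (L : Finset (Fin N)) (M : Finset (Fin N × Fin N)),
    L.card = m ∧ (∀ y ∈ L, (c, y) ∈ S) ∧ M ⊆ S ∧ M.card = n ∧ IsMatch M ∧
      ∀ q ∈ M, q.1 ≠ c ∧ q.2 ∉ L

/-- Exchanging the two sides of the board. -/
def flipCells {N : ℕ} (S : Finset (Fin N × Fin N)) : Finset (Fin N × Fin N) :=
  S.map (Equiv.prodComm _ _).toEmbedding

@[simp] theorem mem_flipCells {N : ℕ} {S : Finset (Fin N × Fin N)} {p : Fin N × Fin N} :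
    p ∈ flipCells S ↔ p.swap ∈ S := by
  rw [flipCells, Finset.mem_map_equiv]; rfl

@[simp] theorem flipCells_flipCells {N : ℕ} (S : Finset (Fin N × Fin N)) : flipCells (flipCells S) = S := by
  ext p; simp

@[simp] theorem card_flipCells {N : ℕ} (S : Finset (Fin N × Fin N)) : (flipCells S).card = S.card :=
  Finset.card_map _

theorem flipCells_insert {N : ℕ} (p : Fin N × Fin N) (S : Finset (Fin N × Fin N)) :
    flipCells (insert p S) = insert p.swap (flipCells S) := by
  ext q; simp [Prod.ext_iff]; tauto

theorem IsMatch.flipCells {N : ℕ} {M : Finset (Fin N × Fin N)} (h : IsMatch M) : IsMatch (flipCells M) := by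
  intro p hp q hq hpq
  exact Prod.swap_injective (h _ (mem_flipCells.1 hp) _ (mem_flipCells.1 hq) hpq.symm)

theorem ContainsCopy.map {W V V' : Type*} {F : SimpleGraph W} {S : Set (Sym2 V)}
    {T : Set (Sym2 V')} (φ : V ↪ V') (h : ContainsCopy F S) (hT : ∀ e ∈ S, e.map φ ∈ T) :
    ContainsCopy F T := by
  obtain ⟨f⟩ := h
  refine ⟨⟨⟨fun w => φ (f w), ?_⟩, fun a b hab => f.injective (φ.injective hab)⟩⟩
  intro a b hab
  have := f.toHom.map_adj hab
  rw [SimpleGraph.fromEdgeSet_adj] at this ⊢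
  refine ⟨?_, fun h => this.2 (φ.injective h)⟩
  have h2 := hT _ this.1
  simpa using h2

theorem CellGoal.prodCongr {m n N : ℕ} (ρ τ : Equiv.Perm (Fin N)) (S : Finset (Fin N × Fin N)) :
    CellGoal m n N (S.map (Equiv.prodCongr ρ τ).toEmbedding) ↔ CellGoal m n N S := by
  have key : ∀ (ρ τ : Equiv.Perm (Fin N)) (S : Finset (Fin N × Fin N)), CellGoal m n N S →
      CellGoal m n N (S.map (Equiv.prodCongr ρ τ).toEmbedding) := by
    intro ρ τ S h
    refine ContainsCopy.map (Equiv.sumCongr ρ τ).toEmbedding h ?_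
    rintro _ ⟨p, hp, rfl⟩
    exact ⟨(ρ p.1, τ p.2), by simpa using hp, by simp [cellEdge]⟩
  refine ⟨fun h => ?_, key ρ τ S⟩
  have := key ρ.symm τ.symm _ h
  convert this
  ext ⟨a, b⟩
  simp

theorem CellGoal.flipCells_iff {m n N : ℕ} (S : Finset (Fin N × Fin N)) :
    CellGoal m n N (flipCells S) ↔ CellGoal m n N S := by
  have key : ∀ (S : Finset (Fin N × Fin N)), CellGoal m n N S → CellGoal m n N (flipCells S) := by
    intro S h
    refine ContainsCopy.map (Equiv.sumComm _ _).toEmbedding h ?_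
    rintro _ ⟨p, hp, rfl⟩
    refine ⟨p.swap, by simpa using hp, ?_⟩
    simp only [cellEdge, Sym2.map_mk]
    exact Sym2.eq_swap
  exact ⟨fun h => by simpa using key _ h, key S⟩

theorem Win.of_flipCells {m n N : ℕ} {B R : Finset (Fin N × Fin N)}
    (h : Win (CellGoal m n N) (flipCells B) (flipCells R)) : Win (CellGoal m n N) B R := by
  have := h.map (Equiv.prodComm _ _) CellGoal.flipCells_iff
  change Win _ (flipCells (flipCells B)) (flipCells (flipCells R)) at this
  simpa using this

theorem HasLeft.cellGoal {m n N : ℕ} {S : Finset (Fin N × Fin N)} (h : HasLeft m n S) :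
    CellGoal m n N S := by
  obtain ⟨c, L, M, hL, hcL, hMS, hM, hmatch, hdisj⟩ := h
  let l : Fin m ≃ L := (finCongr hL.symm).trans L.equivFin.symm
  let μ : Fin n ≃ M := (finCongr hM.symm).trans M.equivFin.symm
  have inj1 : ∀ i j, (μ i).1.1 = (μ j).1.1 → i = j := fun i j hij =>
    μ.injective (Subtype.ext (hmatch _ (μ i).2 _ (μ j).2 (Or.inl hij)))
  have inj2 : ∀ i j, (μ i).1.2 = (μ j).1.2 → i = j := fun i j hij =>
    μ.injective (Subtype.ext (hmatch _ (μ i).2 _ (μ j).2 (Or.inr hij)))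
  let φ : (Fin 1 ⊕ Fin m) ⊕ (Fin n × Fin 2) → Fin N ⊕ Fin N := fun v =>
    match v with
    | .inl (.inl _) => .inl c
    | .inl (.inr i) => .inr (l i).1
    | .inr (j, b) => if b = 0 then .inl (μ j).1.1 else .inr (μ j).1.2
  have hstar : ∀ i, cellEdge (c, (l i).1) ∈ cellEdge '' (S : Set (Fin N × Fin N)) := fun i =>
    ⟨_, hcL _ (l i).2, rfl⟩
  have hedge : ∀ j, cellEdge (μ j).1 ∈ cellEdge '' (S : Set (Fin N × Fin N)) := fun j =>
    ⟨_, hMS (μ j).2, rfl⟩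
  refine ⟨⟨⟨φ, ?_⟩, ?_⟩⟩
  · rintro ((a | i) | ⟨j, b⟩) ((a' | i') | ⟨j', b'⟩) h
    · simp [starMatching] at h
    · rw [SimpleGraph.fromEdgeSet_adj]
      exact ⟨hstar i', by simp [φ]⟩
    · simp [starMatching] at h
    · rw [SimpleGraph.fromEdgeSet_adj]
      refine ⟨?_, by simp [φ]⟩
      have := hstar i
      rw [cellEdge, Sym2.eq_swap] at this
      exact this
    · simp [starMatching] at h
    · simp [starMatching] at h
    · simp [starMatching] at h
    · simp [starMatching] at h
    · simp only [starMatching, SimpleGraph.sum_adj] at h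
      obtain ⟨h1, h2⟩ := h
      subst h1
      rw [SimpleGraph.fromEdgeSet_adj]
      fin_cases b <;> fin_cases b' <;> simp at h2
      · exact ⟨hedge j, by simp [φ]⟩
      · refine ⟨?_, by simp [φ]⟩
        have := hedge j
        rw [cellEdge, Sym2.eq_swap] at this
        exact this
  · have d1 : ∀ j, (μ j).1.1 ≠ c := fun j => (hdisj _ (μ j).2).1
    have d2 : ∀ i j, (μ j).1.2 ≠ (l i).1 := fun i j h => (hdisj _ (μ j).2).2 (h ▸ (l i).2)
    rintro ((a | i) | ⟨j, b⟩) ((a' | i') | ⟨j', b'⟩) h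
    · simp [Subsingleton.elim a a']
    · simp [φ] at h
    · fin_cases b' <;> simp [φ] at h
      exact absurd h.symm (d1 j')
    · simp [φ] at h
    · have : l i = l i' := Subtype.ext (by simpa [φ] using h)
      simp [l.injective this]
    · fin_cases b' <;> simp [φ] at h
      exact absurd h.symm (d2 i j')
    · fin_cases b <;> simp [φ] at h
      exact absurd h (d1 j)
    · fin_cases b <;> simp [φ] at h
      exact absurd h (d2 i' j)
    · fin_cases b <;> fin_cases b' <;> simp [φ] at h
      · simp [inj1 _ _ h]
      · simp [inj2 _ _ h]

theorem cellGoal_iff {m n N : ℕ} {S : Finset (Fin N × Fin N)} :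
    CellGoal m n N S ↔ HasLeft m n S ∨ HasLeft m n (flipCells S) := by
  constructor
  swap
  · rintro (h | h)
    · exact h.cellGoal
    · exact (CellGoal.flipCells_iff S).1 h.cellGoal
  have key : ∀ (S : Finset (Fin N × Fin N))
      (f : SimpleGraph.Copy (starMatching m n) (SimpleGraph.fromEdgeSet (cellEdge '' (S : Set _))))
      (c : Fin N), f (.inl (.inl 0)) = .inl c → HasLeft m n S := by
    intro S f c hc
    have adj : ∀ u v, (SimpleGraph.fromEdgeSet (cellEdge '' (S : Set (Fin N × Fin N)))).Adj u v →
        (∃ p ∈ S, u = .inl p.1 ∧ v = .inr p.2) ∨ (∃ p ∈ S, v = .inl p.1 ∧ u = .inr p.2) := by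
      intro u v h
      rw [SimpleGraph.fromEdgeSet_adj] at h
      obtain ⟨⟨p, hp, hpe⟩, -⟩ := h
      rw [cellEdge, Sym2.eq_iff] at hpe
      rcases hpe with ⟨h1, h2⟩ | ⟨h1, h2⟩
      · exact Or.inl ⟨p, hp, h1.symm, h2.symm⟩
      · exact Or.inr ⟨p, hp, h1.symm, h2.symm⟩
    have hleaf : ∀ i : Fin m, ∃ y, f (.inl (.inr i)) = .inr y ∧ (c, y) ∈ S := by
      intro i
      have : (starMatching m n).Adj (.inl (.inl 0)) (.inl (.inr i)) := by simp [starMatching]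
      rcases adj _ _ (f.toHom.map_adj this) with ⟨p, hp, h1, h2⟩ | ⟨p, hp, h1, h2⟩
      · refine ⟨p.2, h2, ?_⟩
        have : c = p.1 := by
          have h1' : f (.inl (.inl 0)) = .inl p.1 := h1
          rw [hc] at h1'; simpa using h1'
        rw [this]; exact hp
      · have h2' : f (.inl (.inl 0)) = .inr p.2 := h2
        rw [hc] at h2'; simp at h2'
    choose l hl hlS using hleaf
    -- The copy may orient each matching edge either way. Here `b` names the endpoint sent to the
    -- left side, and `b + 1` in `Fin 2` is the other one.
    have hmat : ∀ j : Fin n, ∃ p ∈ S, ∃ b, f (.inr (j, b)) = .inl p.1 ∧ f (.inr (j, b + 1)) = .inr p.2 := by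
      intro j
      have : (starMatching m n).Adj (.inr (j, 0)) (.inr (j, 1)) := by simp [starMatching]
      rcases adj _ _ (f.toHom.map_adj this) with ⟨p, hp, h1, h2⟩ | ⟨p, hp, h1, h2⟩
      · exact ⟨p, hp, 0, h1, h2⟩
      · exact ⟨p, hp, 1, h1, h2⟩
    choose μ hμS b hμ1 hμ2 using hmat
    have m1 : ∀ i j, (μ i).1 = (μ j).1 → i = j := by
      intro i j h
      have : f (.inr (i, b i)) = f (.inr (j, b j)) := by rw [hμ1, hμ1, h]
      have := f.injective this
      simp at this
      exact this.1
    have m2 : ∀ i j, (μ i).2 = (μ j).2 → i = j := by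
      intro i j h
      have : f (.inr (i, b i + 1)) = f (.inr (j, b j + 1)) := by rw [hμ2, hμ2, h]
      have := f.injective this
      simp at this
      exact this.1
    have linj : Function.Injective l := by
      intro i j h
      have : f (.inl (.inr i)) = f (.inl (.inr j)) := by rw [hl, hl, h]
      have := f.injective this
      simpa using this
    refine ⟨c, Finset.univ.image l, Finset.univ.image μ, ?_, ?_, ?_, ?_, ?_, ?_⟩
    · rw [Finset.card_image_of_injective _ linj]; simp
    · simp only [Finset.mem_image, Finset.mem_univ, true_and]
      rintro _ ⟨i, rfl⟩; exact hlS i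
    · intro p hp
      simp only [Finset.mem_image, Finset.mem_univ, true_and] at hp
      obtain ⟨j, rfl⟩ := hp; exact hμS j
    · rw [Finset.card_image_of_injective _ (fun i j h => m1 i j (by rw [h]))]; simp
    · intro p hp q hq
      simp only [Finset.mem_image, Finset.mem_univ, true_and] at hp hq
      obtain ⟨i, rfl⟩ := hp; obtain ⟨j, rfl⟩ := hq
      rintro (h | h)
      · rw [m1 _ _ h]
      · rw [m2 _ _ h]
    · intro q hq
      simp only [Finset.mem_image, Finset.mem_univ, true_and] at hq ⊢
      obtain ⟨j, rfl⟩ := hq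
      refine ⟨fun h => ?_, ?_⟩
      · have : f (.inr (j, b j)) = f (.inl (.inl 0)) := by rw [hμ1, hc, h]
        have := f.injective this
        simp at this
      · rintro ⟨i, h⟩
        have : f (.inr (j, b j + 1)) = f (.inl (.inr i)) := by rw [hμ2, hl, h]
        have := f.injective this
        simp at this
  intro h
  obtain ⟨f⟩ := id h
  rcases hc : f (.inl (.inl 0)) with c | c
  · exact Or.inl (key S f c hc)
  · right
    have sw : ∀ e ∈ cellEdge '' (S : Set (Fin N × Fin N)),
        e.map (Equiv.sumComm (Fin N) (Fin N)).toEmbedding ∈ cellEdge '' (flipCells S : Set (Fin N × Fin N)) := by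
      rintro _ ⟨p, hp, rfl⟩
      refine ⟨p.swap, by simpa using hp, ?_⟩
      simp only [cellEdge, Sym2.map_mk]
      exact Sym2.eq_swap
    let g : SimpleGraph.Copy (starMatching m n)
        (SimpleGraph.fromEdgeSet (cellEdge '' (flipCells S : Set (Fin N × Fin N)))) :=
      ⟨⟨fun w => Equiv.sumComm (Fin N) (Fin N) (f w), by
        intro a b' hab
        have := f.toHom.map_adj hab
        rw [SimpleGraph.fromEdgeSet_adj] at this ⊢
        refine ⟨?_, fun h => this.2 ((Equiv.sumComm _ _).injective h)⟩
        have h2 := sw _ this.1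
        simpa using h2⟩, fun a b' hab => f.injective ((Equiv.sumComm _ _).injective hab)⟩
    refine key (flipCells S) g c ?_
    change Equiv.sumComm (Fin N) (Fin N) (f (.inl (.inl 0))) = _
    rw [hc]; rfl

/-! ### Size bounds for copies and the matching form of the goal -/

theorem HasLeft.card_le {m n N : ℕ} {S : Finset (Fin N × Fin N)} (h : HasLeft m n S) :
    m + n ≤ S.card := by
  obtain ⟨c, L, M, hL, hcL, hMS, hM, hmatch, hdisj⟩ := h
  have hd : Disjoint (({c} : Finset (Fin N)) ×ˢ L) M := by
    rw [Finset.disjoint_left]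
    intro p hp hpM
    simp only [Finset.mem_product, Finset.mem_singleton] at hp
    exact (hdisj p hpM).1 hp.1
  have hsub : (({c} : Finset (Fin N)) ×ˢ L) ∪ M ⊆ S := by
    refine Finset.union_subset (fun p hp => ?_) hMS
    simp only [Finset.mem_product, Finset.mem_singleton] at hp
    have := hcL _ hp.2
    rwa [← hp.1] at this
  have := Finset.card_le_card hsub
  rw [Finset.card_union_of_disjoint hd, Finset.card_product, Finset.card_singleton, hL, hM] at this
  omega

theorem HasLeft.le_size {m n N : ℕ} {S : Finset (Fin N × Fin N)} (h : HasLeft m n S) :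
    m + n ≤ N := by
  obtain ⟨c, L, M, hL, hcL, hMS, hM, hmatch, hdisj⟩ := h
  have hd : Disjoint L (M.image Prod.snd) := by
    rw [Finset.disjoint_right]
    intro y hy
    obtain ⟨q, hq, rfl⟩ := Finset.mem_image.1 hy
    exact (hdisj q hq).2
  have hM' : (M.image Prod.snd).card = n := by
    rw [Finset.card_image_of_injOn (fun p hp q hq h => hmatch p hp q hq (Or.inr h)), hM]
  have := Finset.card_le_univ (L ∪ M.image Prod.snd)
  rw [Finset.card_union_of_disjoint hd, hL, hM'] at this
  simpa using this

theorem CellGoal.card_le {m n N : ℕ} {S : Finset (Fin N × Fin N)} (h : CellGoal m n N S) :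
    m + n ≤ S.card := by
  rcases cellGoal_iff.1 h with h | h
  · exact h.card_le
  · simpa using h.card_le

theorem CellGoal.le_size {m n N : ℕ} {S : Finset (Fin N × Fin N)} (h : CellGoal m n N S) :
    m + n ≤ N := by
  rcases cellGoal_iff.1 h with h | h <;> exact h.le_size

theorem cellGoal_one_iff {n N : ℕ} {S : Finset (Fin N × Fin N)} :
    CellGoal 1 n N S ↔ ∃ M ⊆ S, M.card = n + 1 ∧ IsMatch M := by
  have key : ∀ S : Finset (Fin N × Fin N), HasLeft 1 n S → ∃ M ⊆ S, M.card = n + 1 ∧ IsMatch M := by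
    rintro S ⟨c, L, M, hL, hcL, hMS, hM, hmatch, hdisj⟩
    obtain ⟨y, rfl⟩ := Finset.card_eq_one.1 hL
    have hd := fun q hq => hdisj q hq
    simp only [Finset.mem_singleton] at hd
    refine ⟨insert (c, y) M, Finset.insert_subset (hcL y (by simp)) hMS, ?_, ?_⟩
    · rw [Finset.card_insert_of_notMem (fun h => (hd _ h).1 rfl), hM]
    · intro p hp q hq hpq
      rw [Finset.mem_insert] at hp hq
      rcases hp with rfl | hp <;> rcases hq with rfl | hq
      · rfl
      · have := hd q hq
        rcases hpq with h | h
        · exact absurd h.symm this.1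
        · exact absurd h.symm this.2
      · have := hd p hp
        rcases hpq with h | h
        · exact absurd h this.1
        · exact absurd h this.2
      · exact hmatch p hp q hq hpq
  constructor
  · intro h
    rcases cellGoal_iff.1 h with h | h
    · exact key S h
    · obtain ⟨M, hMS, hM, hm⟩ := key _ h
      refine ⟨flipCells M, fun p hp => ?_, by simpa using hM, hm.flipCells⟩
      simpa using hMS (mem_flipCells.1 hp)
  · rintro ⟨M, hMS, hM, hm⟩
    obtain ⟨p, hp⟩ := Finset.card_pos.1 (by omega : 0 < M.card)
    refine HasLeft.cellGoal ⟨p.1, {p.2}, M.erase p, by simp, ?_, ?_, ?_, ?_, ?_⟩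
    · intro y hy
      rw [Finset.mem_singleton] at hy
      subst hy; exact hMS hp
    · exact (Finset.erase_subset _ _).trans hMS
    · rw [Finset.card_erase_of_mem hp, hM]; rfl
    · exact fun a ha b hb => hm a (Finset.mem_of_mem_erase ha) b (Finset.mem_of_mem_erase hb)
    · intro q hq
      rw [Finset.mem_erase] at hq
      refine ⟨fun h => hq.1 (hm q hq.2 p hp (Or.inl h)), fun h => ?_⟩
      rw [Finset.mem_singleton] at h
      exact hq.1 (hm q hq.2 p hp (Or.inr h))

/-- Following any legal replies down a strategy tree ends at a completed copy, which needs room on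
the board. Rounds require a free cell for Bob, so the descent never stalls. -/
theorem Win.le_size {m n N : ℕ} {B R : Finset (Fin N × Fin N)} (h : Win (CellGoal m n N) B R) :
    m + n ≤ N := by
  induction h with
  | finish B R e heB heR hP => exact hP.le_size
  | round B R e heB heR hne hBob hnext ih =>
    obtain ⟨f, h1, h2⟩ := hne
    exact ih f h1 h2

/-- A round in which Bob has too few edges to complete the goal. -/
theorem Win.step {m n N : ℕ} {B R : Finset (Fin N × Fin N)} (e : Fin N × Fin N) (heB : e ∉ B)
    (heR : e ∉ R) (hBR : B.card = R.card) (hR : R.card + 1 < m + n) (hN : m + n ≤ N)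
    (hnext : ∀ f, f ∉ insert e B → f ∉ R → Win (CellGoal m n N) (insert e B) (insert f R)) :
    Win (CellGoal m n N) B R := by
  refine .round _ _ e heB heR ?_ (fun f h1 h2 h => ?_) hnext
  -- A full board would force $N^2\le 2|R|+1$, whereas $N\ge m+n\ge |R|+2$.
  · by_contra! hcon
    have hsub : Finset.univ ⊆ insert e B ∪ R := by
      intro f _
      rw [Finset.mem_union]
      by_cases hf : f ∈ insert e B
      · exact Or.inl hf
      · exact Or.inr (hcon f hf)
    have := Finset.card_le_card hsub
    have h2 := Finset.card_union_le (insert e B) R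
    have h3 := Finset.card_insert_le e B
    simp only [Finset.card_univ, Fintype.card_prod, Fintype.card_fin] at this
    nlinarith
  · have := h.card_le
    rw [Finset.card_insert_of_notMem h2] at this
    omega

/-! ### Building a matching without losing a move -/

theorem IsMatch.mono {N : ℕ} {M M' : Finset (Fin N × Fin N)} (h : IsMatch M') (hM : M ⊆ M') :
    IsMatch M := fun p hp q hq => h p (hM hp) q (hM hq)

theorem IsMatch.insert {N : ℕ} {M : Finset (Fin N × Fin N)} (h : IsMatch M) {e : Fin N × Fin N}
    (he : ∀ p ∈ M, p.1 ≠ e.1 ∧ p.2 ≠ e.2) : IsMatch (insert e M) := by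
  intro p hp q hq hpq
  rw [Finset.mem_insert] at hp hq
  rcases hp with rfl | hp <;> rcases hq with rfl | hq
  · rfl
  · rcases hpq with h' | h'
    · exact absurd h'.symm (he q hq).1
    · exact absurd h'.symm (he q hq).2
  · rcases hpq with h' | h'
    · exact absurd h' (he p hp).1
    · exact absurd h' (he p hp).2
  · exact h p hp q hq hpq

/-- Alice's edges form a matching of size `j` avoiding the rows `X` and the columns `Y`, and at most
one red edge joins `X` to `Y`. -/
structure MatchState {N : ℕ} (j : ℕ) (B R : Finset (Fin N × Fin N)) (X Y : Finset (Fin N)) :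
    Prop where
  cardB : B.card = j
  cardR : R.card = j
  isMatch : IsMatch B
  cardX : X.card + j = N
  cardY : Y.card + j = N
  disj : ∀ p ∈ B, p.1 ∉ X ∧ p.2 ∉ Y
  red : ∀ p ∈ R, ∀ q ∈ R, p.1 ∈ X → p.2 ∈ Y → q.1 ∈ X → q.2 ∈ Y → p = q

namespace MatchState

variable {N j : ℕ} {B R : Finset (Fin N × Fin N)} {X Y : Finset (Fin N)}

theorem isMatch_insert (h : MatchState j B R X Y) {e : Fin N × Fin N} (h1 : e.1 ∈ X)
    (h2 : e.2 ∈ Y) : IsMatch (insert e B) :=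
  h.isMatch.insert fun p hp =>
    ⟨fun hh => (h.disj p hp).1 (hh ▸ h1), fun hh => (h.disj p hp).2 (hh ▸ h2)⟩

theorem notMem (h : MatchState j B R X Y) {e : Fin N × Fin N} (h1 : e.1 ∈ X) : e ∉ B :=
  fun he => (h.disj e he).1 h1

/-- When Alice's edge leaves no red cell in the reduced block, Bob's reply `f` is the only one that
can be there. -/
theorem succ (h : MatchState j B R X Y) {e f : Fin N × Fin N} (h1 : e.1 ∈ X) (h2 : e.2 ∈ Y)
    (hred : ∀ p ∈ R, p.1 ∈ X.erase e.1 → p.2 ∈ Y.erase e.2 → False) (hf : f ∉ R) :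
    MatchState (j + 1) (insert e B) (insert f R) (X.erase e.1) (Y.erase e.2) where
  cardB := by rw [Finset.card_insert_of_notMem (h.notMem h1), h.cardB]
  cardR := by rw [Finset.card_insert_of_notMem hf, h.cardR]
  isMatch := h.isMatch_insert h1 h2
  cardX := by
    have := Finset.card_erase_add_one h1
    have := h.cardX
    omega
  cardY := by
    have := Finset.card_erase_add_one h2
    have := h.cardY
    omega
  disj := by
    intro p hp
    rw [Finset.mem_insert] at hp
    rcases hp with rfl | hp
    · simp
    · exact ⟨fun hh => (h.disj p hp).1 (Finset.mem_of_mem_erase hh),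
        fun hh => (h.disj p hp).2 (Finset.mem_of_mem_erase hh)⟩
  red := by
    intro p hp q hq p1 p2 q1 q2
    rw [Finset.mem_insert] at hp hq
    rcases hp with rfl | hp
    · rcases hq with rfl | hq
      · rfl
      · exact (hred q hq q1 q2).elim
    · exact (hred p hp p1 p2).elim

/-- Alice can extend her matching so that no red edge joins the remaining rows and columns. -/
theorem exists_move (h : MatchState j B R X Y) (hj : j + 2 ≤ N) :
    ∃ e : Fin N × Fin N, e.1 ∈ X ∧ e.2 ∈ Y ∧ e ∉ R ∧
      ∀ p ∈ R, p.1 ∈ X.erase e.1 → p.2 ∈ Y.erase e.2 → False := by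
  have hX := h.cardX
  have hY := h.cardY
  by_cases hr : ∃ r ∈ R, r.1 ∈ X ∧ r.2 ∈ Y
  · obtain ⟨r, hr, r1, r2⟩ := hr
    have : 0 < (Y.erase r.2).card := by
      have := Finset.card_erase_add_one r2
      omega
    obtain ⟨y, hy⟩ := Finset.card_pos.1 this
    rw [Finset.mem_erase] at hy
    -- Playing in the row of the unique red cell `r` removes that row, and `r` with it, from the
    -- block.
    refine ⟨(r.1, y), r1, hy.2, fun he => ?_, fun p hp p1 p2 => ?_⟩
    · exact hy.1 (congrArg Prod.snd (h.red _ he r hr r1 hy.2 r1 r2))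
    · rw [Finset.mem_erase] at p1 p2
      have hpr := h.red p hp r hr p1.2 p2.2 r1 r2
      exact p1.1 (by rw [hpr])
  · push Not at hr
    obtain ⟨x, hx⟩ := Finset.card_pos.1 (by omega : 0 < X.card)
    obtain ⟨y, hy⟩ := Finset.card_pos.1 (by omega : 0 < Y.card)
    exact ⟨(x, y), hx, hy, fun he => hr _ he hx hy, fun p hp p1 p2 =>
      hr p hp (Finset.mem_of_mem_erase p1) (Finset.mem_of_mem_erase p2)⟩

theorem win {m n J : ℕ} (hJ : J + 1 ≤ N) (hJm : J < m + n) (hN : m + n ≤ N)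
    (hgoal : ∀ (B R : Finset (Fin N × Fin N)) (X Y : Finset (Fin N)), MatchState J B R X Y →
      Win (CellGoal m n N) B R) :
    ∀ (i j : ℕ) (B R : Finset (Fin N × Fin N)) (X Y : Finset (Fin N)), j + i = J →
      MatchState j B R X Y → Win (CellGoal m n N) B R := by
  intro i
  induction i with
  | zero => rintro j B R X Y rfl h; exact hgoal B R X Y h
  | succ i ih =>
    intro j B R X Y hij h
    obtain ⟨e, e1, e2, eR, hred⟩ := h.exists_move (by omega)
    refine Win.step e (h.notMem e1) eR (h.cardB.trans h.cardR.symm) ?_ hN fun f _ hfR => ?_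
    · rw [h.cardR]; omega
    · exact ih (j + 1) _ _ _ _ (by omega) (h.succ e1 e2 hred hfR)

theorem initial (N : ℕ) : MatchState (N := N) 0 ∅ ∅ Finset.univ Finset.univ where
  cardB := rfl
  cardR := rfl
  isMatch := fun p hp => absurd hp (Finset.notMem_empty p)
  cardX := by simp
  cardY := by simp
  disj := fun p hp => absurd hp (Finset.notMem_empty p)
  red := fun p hp => absurd hp (Finset.notMem_empty p)

end MatchState

/-- Alice wins if she wins from every position reached by matching `J` rows with `J` columns. -/
theorem win_of_matchState {m n N J : ℕ} (hJ : J + 1 ≤ N) (hJm : J < m + n) (hN : m + n ≤ N)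
    (hgoal : ∀ (B R : Finset (Fin N × Fin N)) (X Y : Finset (Fin N)), MatchState J B R X Y →
      Win (CellGoal m n N) B R) : Win (CellGoal m n N) ∅ ∅ :=
  MatchState.win hJ hJm hN hgoal J 0 ∅ ∅ _ _ (by omega) (MatchState.initial N)

/-- After `n` rounds a $2\times2$ block is left with at most one red cell, so the last edge is
available. -/
theorem win_matching (n : ℕ) : Win (CellGoal 1 n (n + 2)) ∅ ∅ := by
  refine win_of_matchState (J := n) (by omega) (by omega) (by omega) fun B R X Y h => ?_
  obtain ⟨e, e1, e2, eR, -⟩ := h.exists_move (by omega)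
  refine .finish _ _ e (h.notMem e1) eR (cellGoal_one_iff.2 ⟨_, subset_rfl, ?_, ?_⟩)
  · rw [Finset.card_insert_of_notMem (h.notMem e1), h.cardB]
  · exact h.isMatch_insert e1 e2

theorem hasLeft_two {n N : ℕ} {B : Finset (Fin N × Fin N)} (hB : IsMatch B) (hc : B.card = n + 1)
    {p : Fin N × Fin N} (hp : p ∈ B) {y : Fin N} (hy : ∀ q ∈ B, q.2 ≠ y) :
    HasLeft 2 n (insert (p.1, y) B) := by
  refine ⟨p.1, {p.2, y}, B.erase p, Finset.card_pair (hy p hp), ?_, ?_, ?_, ?_, ?_⟩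
  · intro z hz
    simp only [Finset.mem_insert, Finset.mem_singleton] at hz
    rcases hz with rfl | rfl
    · exact Finset.mem_insert_of_mem hp
    · exact Finset.mem_insert_self _ _
  · exact (Finset.erase_subset _ _).trans (Finset.subset_insert _ _)
  · rw [Finset.card_erase_of_mem hp, hc]; rfl
  · exact hB.mono (Finset.erase_subset _ _)
  · intro q hq
    rw [Finset.mem_erase] at hq
    simp only [Finset.mem_insert, Finset.mem_singleton, not_or]
    exact ⟨fun h => hq.1 (hB q hq.2 p hp (Or.inl h)), fun h => hq.1 (hB q hq.2 p hp (Or.inr h)),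
      hy q hq.2⟩

/-- After `n + 1` rounds one row `x` and one column `y` are unused. Joining either to any matching
edge turns that edge into a $K_{1,2}$. This gives $2(n+1)$ winning cells, and Bob owns only $n+1$.
-/
theorem win_two (n : ℕ) : Win (CellGoal 2 n (n + 2)) ∅ ∅ := by
  refine win_of_matchState (J := n + 1) (by omega) (by omega) (by omega) fun B R X Y h => ?_
  have hX := h.cardX
  have hY := h.cardY
  obtain ⟨x, rfl⟩ := Finset.card_eq_one.1 (by omega : X.card = 1)
  obtain ⟨y, rfl⟩ := Finset.card_eq_one.1 (by omega : Y.card = 1)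
  have hd := h.disj
  simp only [Finset.mem_singleton] at hd
  by_cases h1 : ∃ p ∈ B, (p.1, y) ∉ R
  · obtain ⟨p, hp, hpR⟩ := h1
    exact .finish _ _ (p.1, y) (fun hh => (hd _ hh).2 rfl) hpR
      (hasLeft_two h.isMatch h.cardB hp fun q hq => (hd q hq).2).cellGoal
  by_cases h2 : ∃ p ∈ B, (x, p.2) ∉ R
  · obtain ⟨p, hp, hpR⟩ := h2
    refine .finish _ _ (x, p.2) (fun hh => (hd _ hh).1 rfl) hpR ?_
    rw [← CellGoal.flipCells_iff, flipCells_insert]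
    refine (hasLeft_two (p := p.swap) h.isMatch.flipCells (by simpa using h.cardB)
      (by simpa using hp) fun q hq => ?_).cellGoal
    exact (hd _ (mem_flipCells.1 hq)).1
  exfalso
  push Not at h1 h2
  have c1 : (B.image fun p => (p.1, y)).card = n + 1 := by
    rw [Finset.card_image_of_injOn, h.cardB]
    intro p hp q hq hpq
    exact h.isMatch p hp q hq (Or.inl (Prod.mk.inj hpq).1)
  have c2 : (B.image fun p => (x, p.2)).card = n + 1 := by
    rw [Finset.card_image_of_injOn, h.cardB]
    intro p hp q hq hpq
    exact h.isMatch p hp q hq (Or.inr (Prod.mk.inj hpq).2)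
  have hdis : Disjoint (B.image fun p => (p.1, y)) (B.image fun p => (x, p.2)) := by
    rw [Finset.disjoint_left]
    intro r hr hr'
    obtain ⟨p, hp, rfl⟩ := Finset.mem_image.1 hr
    obtain ⟨q, hq, hqe⟩ := Finset.mem_image.1 hr'
    exact (hd p hp).1 (congrArg Prod.fst hqe).symm
  have hsub : (B.image fun p => (p.1, y)) ∪ (B.image fun p => (x, p.2)) ⊆ R := by
    intro r hr
    rw [Finset.mem_union] at hr
    rcases hr with hr | hr
    · obtain ⟨p, hp, rfl⟩ := Finset.mem_image.1 hr; exact h1 p hp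
    · obtain ⟨p, hp, rfl⟩ := Finset.mem_image.1 hr; exact h2 p hp
  have := Finset.card_le_card hsub
  rw [Finset.card_union_of_disjoint hdis, c1, c2, h.cardR] at this
  omega

/-! ### The perfect matching game -/

theorem IsMatch.exists_snd {N : ℕ} {M : Finset (Fin N × Fin N)} (h : IsMatch M) (hc : M.card = N)
    (y : Fin N) : ∃ s ∈ M, s.2 = y := by
  have : M.image Prod.snd = Finset.univ := by
    rw [← Finset.card_eq_iff_eq_univ,
      Finset.card_image_of_injOn (fun p hp q hq hpq => h p hp q hq (Or.inr hpq)), hc]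
    simp
  have hy := Finset.mem_univ y
  rw [← this] at hy
  simpa using hy

theorem IsMatch.exists_fst {N : ℕ} {M : Finset (Fin N × Fin N)} (h : IsMatch M) (hc : M.card = N)
    (x : Fin N) : ∃ s ∈ M, s.1 = x := by
  obtain ⟨s, hs, hsx⟩ := h.flipCells.exists_snd (by simpa using hc) x
  exact ⟨s.swap, mem_flipCells.1 hs, hsx⟩

/-- Alice has an almost perfect matching `B` missing only row `x` and column `y`. She plays
`(x, p.2)`, which forces `(p.1, y)`, and then `(q.1, y)`, which makes two threats. -/
theorem win_of_doubleThreat {n N : ℕ} {B R : Finset (Fin N × Fin N)} (hB : IsMatch B)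
    (hc : B.card = n) {x y : Fin N} (hx : ∀ p ∈ B, p.1 ≠ x) (hy : ∀ p ∈ B, p.2 ≠ y)
    {p q : Fin N × Fin N} (hp : p ∈ B) (hq : q ∈ B) (hpq : p ≠ q)
    (h1 : (x, p.2) ∉ R) (h2 : (p.1, y) ∉ R) (h3 : (q.1, y) ∉ R) (h4 : (x, q.2) ∉ R)
    (h5 : (p.1, q.2) ∉ R)
    (hBob : ∀ M : Finset (Fin N × Fin N), IsMatch M → M.card = n + 1 →
      ∀ e ∉ insert (x, p.2) B, ¬ M ⊆ insert e (insert (p.1, y) R)) :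
    Win (CellGoal 1 n N) B R := by
  have n1 : p.1 ≠ q.1 := fun h => hpq (hB p hp q hq (Or.inl h))
  have n2 : p.2 ≠ q.2 := fun h => hpq (hB p hp q hq (Or.inr h))
  have hcp : (B.erase p).card + 1 = n := by rw [Finset.card_erase_add_one hp, hc]
  have hcq : (B.erase q).card + 1 = n := by rw [Finset.card_erase_add_one hq, hc]
  have hqp : q ∈ B.erase p := Finset.mem_erase.2 ⟨hpq.symm, hq⟩
  have hcpq : ((B.erase p).erase q).card + 2 = n := by
    have := Finset.card_erase_add_one hqp
    omega
  have row : ∀ z, (x, z) ∉ B := fun z h => hx _ h rfl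
  have col : ∀ z, (z, y) ∉ B := fun z h => hy _ h rfl
  have hab : (p.1, q.2) ∉ B := fun h => n2 (by rw [← hB _ h p hp (Or.inl rfl)])
  have yp : p.2 ≠ y := hy p hp
  have yq : q.2 ≠ y := hy q hq
  have xp : p.1 ≠ x := hx p hp
  have xq : q.1 ≠ x := hx q hq
  -- The basic exchange: replacing `r` by `(x, r.2)` and `(r.1, y)` makes the almost perfect
  -- matching perfect.
  have swapEnd : ∀ r ∈ B, ∀ S : Finset (Fin N × Fin N),
      insert (r.1, y) (insert (x, r.2) (B.erase r)) ⊆ S → CellGoal 1 n N S := by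
    intro r hr S hS
    have m1 : IsMatch (insert (x, r.2) (B.erase r)) := by
      refine (hB.mono (Finset.erase_subset _ _)).insert fun t ht => ?_
      rw [Finset.mem_erase] at ht
      exact ⟨hx t ht.2, fun h => ht.1 (hB t ht.2 r hr (Or.inr h))⟩
    have m2 : IsMatch (insert (r.1, y) (insert (x, r.2) (B.erase r))) := by
      refine m1.insert fun t ht => ?_
      rw [Finset.mem_insert, Finset.mem_erase] at ht
      rcases ht with rfl | ht
      · exact ⟨(hx r hr).symm, hy r hr⟩
      · exact ⟨fun h => ht.1 (hB t ht.2 r hr (Or.inl h)), hy t ht.2⟩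
    refine cellGoal_one_iff.2 ⟨_, hS, ?_, m2⟩
    have c := Finset.card_erase_add_one hr
    rw [Finset.card_insert_of_notMem, Finset.card_insert_of_notMem]
    · omega
    · exact fun h => row _ (Finset.mem_of_mem_erase h)
    · intro h
      rw [Finset.mem_insert] at h
      rcases h with h | h
      · exact hx r hr (Prod.mk.inj h).1
      · exact col _ (Finset.mem_of_mem_erase h)
  refine .round _ _ (x, p.2) (row _) h1 ⟨(p.1, y), by simp [xp, col], h2⟩ ?_ ?_
  · intro f hf _ hP
    obtain ⟨M, hMS, hM, hm⟩ := cellGoal_one_iff.1 hP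
    -- `hBob` speaks of the position after the forced reply `(p.1, y)`; it covers this earlier reply
    -- too, since fewer cells are red.
    exact hBob M hm hM f hf (hMS.trans (Finset.insert_subset_insert _ (Finset.subset_insert _ _)))
  intro f hf hfR
  by_cases hfe : f = (p.1, y)
  swap
  · refine .finish _ _ (p.1, y) (by simp [xp, col]) (by simp [h2, Ne.symm hfe]) ?_
    refine swapEnd p hp _ ?_
    exact Finset.insert_subset_insert _ (Finset.insert_subset_insert _ (Finset.erase_subset _ _))
  subst hfe
  refine .round _ _ (q.1, y) (by simp [xq, col]) (by simp [h3, n1.symm])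
    ⟨(x, q.2), by simp [xq.symm, n2.symm, row], by simp [xp.symm, h4]⟩ ?_ ?_
  · intro g hg _ hP
    obtain ⟨M, hMS, hM, hm⟩ := cellGoal_one_iff.1 hP
    exact hBob M hm hM g (fun h => hg (Finset.mem_insert_of_mem h)) hMS
  intro g hg hgR
  by_cases hge : g = (x, q.2)
  swap
  · refine .finish _ _ (x, q.2) (by simp [xq.symm, n2.symm, row])
      (by simp [xp.symm, h4, Ne.symm hge]) ?_
    refine swapEnd q hq _ ?_
    rw [Finset.insert_comm]
    refine Finset.insert_subset_insert _ (Finset.insert_subset_insert _ ?_)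
    exact (Finset.erase_subset _ _).trans (Finset.subset_insert _ _)
  subst hge
  -- The second threat replaces both `p` and `q` by the three edges `(x, p.2)`, `(q.1, y)` and
  -- `(p.1, q.2)`.
  refine .finish _ _ (p.1, q.2) (by simp [xp, n1, hab]) (by simp [xp, yq, h5]) ?_
  have mem3 : ∀ t ∈ (B.erase p).erase q, t ∈ B ∧ t ≠ p ∧ t ≠ q := by
    intro t ht
    rw [Finset.mem_erase, Finset.mem_erase] at ht
    exact ⟨ht.2.2, ht.2.1, ht.1⟩
  have m1 : IsMatch (insert (x, p.2) ((B.erase p).erase q)) := by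
    refine (hB.mono fun t ht => (mem3 t ht).1).insert fun t ht => ?_
    obtain ⟨a, b, c⟩ := mem3 t ht
    exact ⟨hx t a, fun h => b (hB t a p hp (Or.inr h))⟩
  have m2 : IsMatch (insert (q.1, y) (insert (x, p.2) ((B.erase p).erase q))) := by
    refine m1.insert fun t ht => ?_
    rw [Finset.mem_insert] at ht
    rcases ht with rfl | ht
    · exact ⟨xq.symm, yp⟩
    · obtain ⟨a, b, c⟩ := mem3 t ht
      exact ⟨fun h => c (hB t a q hq (Or.inl h)), hy t a⟩
  have m3 : IsMatch
      (insert (p.1, q.2) (insert (q.1, y) (insert (x, p.2) ((B.erase p).erase q)))) := by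
    refine m2.insert fun t ht => ?_
    rw [Finset.mem_insert, Finset.mem_insert] at ht
    rcases ht with rfl | rfl | ht
    · exact ⟨n1.symm, yq.symm⟩
    · exact ⟨xp.symm, n2⟩
    · obtain ⟨a, b, c⟩ := mem3 t ht
      exact ⟨fun h => b (hB t a p hp (Or.inl h)), fun h => c (hB t a q hq (Or.inr h))⟩
  refine cellGoal_one_iff.2 ⟨_, ?_, ?_, m3⟩
  · refine Finset.insert_subset_insert _ (Finset.insert_subset_insert _
      (Finset.insert_subset_insert _ fun t ht => (mem3 t ht).1))
  · have i1 : (x, p.2) ∉ (B.erase p).erase q := fun h => row _ (mem3 _ h).1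
    have i2 : (q.1, y) ∉ insert (x, p.2) ((B.erase p).erase q) := by
      rw [Finset.mem_insert, not_or]
      exact ⟨fun h => xq (Prod.mk.inj h).1, fun h => col _ (mem3 _ h).1⟩
    have i3 : (p.1, q.2) ∉ insert (q.1, y) (insert (x, p.2) ((B.erase p).erase q)) := by
      rw [Finset.mem_insert, Finset.mem_insert, not_or, not_or]
      exact ⟨fun h => n1 (Prod.mk.inj h).1, fun h => xp (Prod.mk.inj h).1,
        fun h => hab (mem3 _ h).1⟩
    rw [Finset.card_insert_of_notMem i3, Finset.card_insert_of_notMem i2,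
      Finset.card_insert_of_notMem i1]
    omega

/-- A set of at most `n + 2` edges two of which are unused holds no `n + 1` edges. -/
theorem not_subset_of_two_unused {ε : Type*} [DecidableEq ε] {n : ℕ} {M T : Finset ε}
    (hM : M.card = n + 1) (hT : T.card ≤ n + 2) {s t : ε} (hs : s ∈ T) (ht : t ∈ T) (hst : s ≠ t)
    (hsM : s ∉ M) (htM : t ∉ M) : ¬ M ⊆ T := by
  intro h
  have hsub : M ⊆ (T.erase s).erase t := fun r hr =>
    Finset.mem_erase.2 ⟨fun hh => htM (hh ▸ hr), Finset.mem_erase.2 ⟨fun hh => hsM (hh ▸ hr), h hr⟩⟩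
  have c1 := Finset.card_le_card hsub
  have c2 := Finset.card_erase_add_one hs
  have c3 := Finset.card_erase_add_one (Finset.mem_erase.2 ⟨hst.symm, ht⟩)
  omega

theorem card_insert_insert_insert_le {ε : Type*} [DecidableEq ε] (a b c : ε) (R : Finset ε) :
    (insert a (insert b (insert c R))).card ≤ R.card + 3 := by
  have h1 := Finset.card_insert_le a (insert b (insert c R))
  have h2 := Finset.card_insert_le b (insert c R)
  have h3 := Finset.card_insert_le c R
  omega

/-- Bob has at most `n + 2` edges and needs `n + 1` of them, but three lie in column `y`, where a
matching uses at most one. -/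
theorem not_subset_of_column {n N : ℕ} {M R : Finset (Fin N × Fin N)} (hm : IsMatch M)
    (hM : M.card = n + 1) (hR : R.card + 1 = n) {x y a : Fin N} (hax : a ≠ x)
    (hxy : (x, y) ∉ R) (hay : (a, y) ∉ R) {r : Fin N × Fin N} (hr : r ∈ R) (hry : r.2 = y)
    (e : Fin N × Fin N) : ¬ M ⊆ insert e (insert (a, y) (insert (x, y) R)) := by
  have hT := card_insert_insert_insert_le e (a, y) (x, y) R
  have r1 : r ≠ (x, y) := fun h => hxy (h ▸ hr)
  have r2 : r ≠ (a, y) := fun h => hay (h ▸ hr)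
  have r3 : (x, y) ≠ (a, y) := fun h => hax (Prod.mk.inj h).1.symm
  by_cases h1 : r ∈ M
  · refine not_subset_of_two_unused hM (by omega) (s := (x, y)) (t := (a, y)) (by simp) (by simp)
      r3 (fun h => r1 (hm _ h1 _ h (Or.inr hry))) (fun h => r2 (hm _ h1 _ h (Or.inr hry)))
  · by_cases h2 : (x, y) ∈ M
    · exact not_subset_of_two_unused hM (by omega) (s := r) (t := (a, y)) (by simp [hr]) (by simp)
        r2 h1 (fun h => r3 (hm _ h2 _ h (Or.inr rfl)))
    · exact not_subset_of_two_unused hM (by omega) (s := r) (t := (x, y)) (by simp [hr]) (by simp)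
        r1 h1 h2

/-- One edge is wasted inside `R`, and another among the two new edges in column `y`. -/
theorem not_subset_of_not_isMatch {n N : ℕ} {M R : Finset (Fin N × Fin N)} (hm : IsMatch M)
    (hM : M.card = n + 1) (hR : R.card + 1 = n) {x y a : Fin N} (hax : a ≠ x)
    (hxy : (x, y) ∉ R) (hay : (a, y) ∉ R) (hn : ¬ IsMatch R)
    (e : Fin N × Fin N) : ¬ M ⊆ insert e (insert (a, y) (insert (x, y) R)) := by
  have hT := card_insert_insert_insert_le e (a, y) (x, y) R
  have r3 : (x, y) ≠ (a, y) := fun h => hax (Prod.mk.inj h).1.symm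
  have u1 : ∃ s ∈ R, s ∉ M := by
    by_contra! hcon
    exact hn (hm.mono hcon)
  obtain ⟨s, hs, hsM⟩ := u1
  have s1 : s ≠ (x, y) := fun h => hxy (h ▸ hs)
  have s2 : s ≠ (a, y) := fun h => hay (h ▸ hs)
  by_cases h2 : (x, y) ∈ M
  · exact not_subset_of_two_unused hM (by omega) (s := s) (t := (a, y)) (by simp [hs]) (by simp)
      s2 hsM (fun h => r3 (hm _ h2 _ h (Or.inr rfl)))
  · exact not_subset_of_two_unused hM (by omega) (s := s) (t := (x, y)) (by simp [hs]) (by simp)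
      s1 hsM h2

/-- Let $t$ red cells meet row `x` or column `y`. Each spoils at most one edge of `B`, so $g\ge
n-t\ge 2$ edges remain exchangeable. Were all cells `(p.1, q.2)` for distinct exchangeable `p`, `q`
red, then $g(g-1)\le n-1-t\le g-1$, which is impossible. -/
theorem exists_doubleThreat {n N : ℕ} {B R : Finset (Fin N × Fin N)} (hB : IsMatch B)
    (hc : B.card = n) (hR : R.card + 1 = n) {x y : Fin N} (hx : ∀ p ∈ B, p.1 ≠ x)
    (hy : ∀ p ∈ B, p.2 ≠ y) (ht : (R.filter fun r => r.1 = x ∨ r.2 = y).card + 1 < n) :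
    ∃ p ∈ B, ∃ q ∈ B, p ≠ q ∧ (x, p.2) ∉ R ∧ (p.1, y) ∉ R ∧ (q.1, y) ∉ R ∧ (x, q.2) ∉ R ∧
      (p.1, q.2) ∉ R := by
  classical
  set G := B.filter fun p => (x, p.2) ∉ R ∧ (p.1, y) ∉ R with hG
  set K := B.filter fun p => ¬ ((x, p.2) ∉ R ∧ (p.1, y) ∉ R) with hK
  set T := R.filter fun r => r.1 = x ∨ r.2 = y with hT
  set O := R.filter fun r => ¬ (r.1 = x ∨ r.2 = y) with hO
  have e1 : G.card + K.card = B.card := Finset.card_filter_add_card_filter_not _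
  have e2 : T.card + O.card = R.card := Finset.card_filter_add_card_filter_not _
  have e3 : K.card ≤ T.card := by
    refine Finset.card_le_card_of_injOn
      (fun p => if (x, p.2) ∈ R then (x, p.2) else (p.1, y)) ?_ ?_
    · intro p hp
      simp only [hK, Finset.coe_filter, Set.mem_ofPred_eq] at hp
      simp only [hT, Finset.coe_filter, Set.mem_ofPred_eq]
      split_ifs with h
      · exact ⟨h, Or.inl rfl⟩
      · refine ⟨?_, Or.inr rfl⟩
        by_contra h'
        exact hp.2 ⟨h, h'⟩
    · intro p hp q hq hpq
      simp only [hK, Finset.coe_filter, Set.mem_ofPred_eq] at hp hq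
      simp only at hpq
      split_ifs at hpq
      · exact hB p hp.1 q hq.1 (Or.inr (Prod.mk.inj hpq).2)
      · exact absurd (Prod.mk.inj hpq).1.symm (hx q hq.1)
      · exact absurd (Prod.mk.inj hpq).1 (hx p hp.1)
      · exact hB p hp.1 q hq.1 (Or.inl (Prod.mk.inj hpq).1)
  by_contra! hcon
  have e4 : G.offDiag.card ≤ O.card := by
    refine Finset.card_le_card_of_injOn (fun pq => (pq.1.1, pq.2.2)) ?_ ?_
    · rintro ⟨p, q⟩ hpq
      simp only [Finset.coe_offDiag, Set.mem_offDiag, hG, Finset.coe_filter,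
        Set.mem_ofPred_eq] at hpq
      obtain ⟨⟨hp, p1, p2⟩, ⟨hq, q1, q2⟩, hne⟩ := hpq
      simp only [hO, Finset.coe_filter, Set.mem_ofPred_eq, not_or]
      exact ⟨hcon p hp q hq hne p1 p2 q2 q1, hx p hp, hy q hq⟩
    · rintro ⟨p, q⟩ hpq ⟨p', q'⟩ hpq' h
      simp only [Finset.coe_offDiag, Set.mem_offDiag, hG, Finset.coe_filter,
        Set.mem_ofPred_eq] at hpq hpq'
      obtain ⟨h1, h2⟩ := Prod.mk.inj h
      rw [hB p hpq.1.1 p' hpq'.1.1 (Or.inl h1), hB q hpq.2.1.1 q' hpq'.2.1.1 (Or.inr h2)]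
  rw [Finset.offDiag_card] at e4
  have s2 : 2 ≤ G.card := by omega
  have : 2 * G.card ≤ G.card * G.card := Nat.mul_le_mul_right _ s2
  omega

/-- The position after Bob has closed the last cell `(x, y)` left by an almost perfect matching. -/
theorem win_of_almostPerfect {n N : ℕ} {B R : Finset (Fin N × Fin N)} (hB : IsMatch B)
    (hc : B.card = n) (hR : R.card + 1 = n) {x y : Fin N} (hx : ∀ p ∈ B, p.1 ≠ x)
    (hy : ∀ p ∈ B, p.2 ≠ y) (hxy : (x, y) ∉ R)
    (ht : (R.filter fun r => r.1 = x ∨ r.2 = y).card + 1 < n)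
    (hw : ¬ IsMatch R ∨ ∃ r ∈ R, r.1 = x ∨ r.2 = y) :
    Win (CellGoal 1 n N) B (insert (x, y) R) := by
  obtain ⟨p, hp, q, hq, hpq, h1, h2, h3, h4, h5⟩ := exists_doubleThreat hB hc hR hx hy ht
  have xp := hx p hp
  have xq := hx q hq
  have yp := hy p hp
  have yq := hy q hq
  by_cases hcase : ¬ IsMatch R ∨ ∃ r ∈ R, r.2 = y
  · refine win_of_doubleThreat hB hc hx hy hp hq hpq (by simp [h1, yp]) (by simp [h2, xp])
      (by simp [h3, xq]) (by simp [h4, yq]) (by simp [h5, xp]) ?_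
    intro M hm hM e _
    rcases hcase with hn | ⟨r, hr, hry⟩
    · exact not_subset_of_not_isMatch hm hM hR xp hxy h2 hn e
    · exact not_subset_of_column hm hM hR xp hxy h2 hr hry e
  · push Not at hcase
    obtain ⟨r, hr, hrx⟩ : ∃ r ∈ R, r.1 = x := by
      rcases hw with h | ⟨r, hr, h | h⟩
      · exact absurd hcase.1 h
      · exact ⟨r, hr, h⟩
      · exact absurd h (hcase.2 r hr)
    -- The wasted red edge is now in row `x`, so the sides are exchanged. The roles of `p` and `q`
    -- are exchanged as well, which keeps the cell of the second threat at `(p.1, q.2)`.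
    refine Win.of_flipCells ?_
    rw [flipCells_insert]
    refine win_of_doubleThreat (x := y) (y := x) (p := q.swap) (q := p.swap) hB.flipCells
      (by simpa using hc) (fun t ht => hy _ (mem_flipCells.1 ht))
      (fun t ht => hx _ (mem_flipCells.1 ht)) (by simpa using hq) (by simpa using hp)
      (fun h => hpq (Prod.swap_injective h).symm) (by simp [h3, xq]) (by simp [h4, yq])
      (by simp [h1, yp]) (by simp [h2, xp]) (by simp [h5, xp]) ?_
    intro M hm hM e _
    exact not_subset_of_column hm hM (by simpa using hR) yq (by simpa using hxy)
      (by simpa using h4) (r := r.swap) (by simpa using hr) hrx e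

namespace MatchState

variable {N n : ℕ} {B R : Finset (Fin N × Fin N)} {X Y : Finset (Fin N)}

theorem flipCells {j : ℕ} (h : MatchState j B R X Y) :
    MatchState j (flipCells B) (flipCells R) Y X where
  cardB := by simpa using h.cardB
  cardR := by simpa using h.cardR
  isMatch := h.isMatch.flipCells
  cardX := h.cardY
  cardY := h.cardX
  disj := fun p hp => (h.disj _ (mem_flipCells.1 hp)).symm
  red := fun p hp q hq p1 p2 q1 q2 => Prod.swap_injective
    (h.red _ (mem_flipCells.1 hp) _ (mem_flipCells.1 hq) p2 p1 q2 q1)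

theorem exists_ne_fst {j : ℕ} (h : MatchState j B R X Y) (hj : j + 2 = N) (x : Fin N) :
    ∃ x' ∈ X, x' ≠ x :=
  Finset.exists_mem_ne (by have := h.cardX; omega) x

theorem exists_ne_snd {j : ℕ} (h : MatchState j B R X Y) (hj : j + 2 = N) (y : Fin N) :
    ∃ y' ∈ Y, y' ≠ y :=
  Finset.exists_mem_ne (by have := h.cardY; omega) y

/-- Alice takes `(x', y')` and it remains to win after Bob closes `(x, y)`. -/
theorem win_of_close (h : MatchState (n - 1) B R X Y) (hn : 1 ≤ n) (hN : N = n + 1)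
    {x x' y y' : Fin N} (hx : x ∈ X) (hx' : x' ∈ X) (hxx : x' ≠ x) (hy : y ∈ Y) (hy' : y' ∈ Y)
    (hyy : y' ≠ y) (hxy : (x, y) ∉ R) (hxy' : (x', y') ∉ R)
    (hw : Win (CellGoal 1 n N) (insert (x', y') B) (insert (x, y) R)) :
    Win (CellGoal 1 n N) B R := by
  refine Win.step (x', y') (h.notMem hx') hxy' (h.cardB.trans h.cardR.symm)
    (by rw [h.cardR]; omega) (by omega) fun f hf hfR => ?_
  by_cases hfe : f = (x, y)
  · rw [hfe]; exact hw
  have hnew : (x, y) ∉ insert (x', y') B := by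
    rw [Finset.mem_insert, not_or]
    exact ⟨fun hh => hxx (Prod.mk.inj hh).1.symm, h.notMem hx⟩
  refine .finish _ _ (x, y) hnew (by simp [Ne.symm hfe, hxy]) ?_
  refine cellGoal_one_iff.2 ⟨_, subset_rfl, ?_, ?_⟩
  · rw [Finset.card_insert_of_notMem hnew, Finset.card_insert_of_notMem (h.notMem hx'), h.cardB]
    omega
  · refine (h.isMatch_insert (e := (x', y')) hx' hy').insert fun p hp => ?_
    rw [Finset.mem_insert] at hp
    rcases hp with rfl | hp
    · exact ⟨hxx, hyy⟩
    · exact ⟨fun hh => (h.disj p hp).1 (hh ▸ hx), fun hh => (h.disj p hp).2 (hh ▸ hy)⟩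

/-- `ht` provides a red cell off the lines `x` and `y`, as the count in `exists_doubleThreat` needs;
`hw` makes Bob waste enough edges. -/
theorem win_of_touch (h : MatchState (n - 1) B R X Y) (hn : 1 ≤ n) (hN : N = n + 1)
    {x x' y y' : Fin N} (hx : x ∈ X) (hx' : x' ∈ X) (hxx : x' ≠ x) (hy : y ∈ Y) (hy' : y' ∈ Y)
    (hyy : y' ≠ y) (hxy : (x, y) ∉ R) (hxy' : (x', y') ∉ R)
    (ht : ∃ r ∈ R, r.1 ≠ x ∧ r.2 ≠ y)
    (hw : ¬ IsMatch R ∨ ∃ r ∈ R, r.1 = x ∨ r.2 = y) :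
    Win (CellGoal 1 n N) B R := by
  refine h.win_of_close hn hN hx hx' hxx hy hy' hyy hxy hxy' ?_
  have hcard : (insert (x', y') B).card = n := by
    rw [Finset.card_insert_of_notMem (h.notMem hx'), h.cardB]; omega
  refine win_of_almostPerfect (h.isMatch_insert hx' hy') hcard (by rw [h.cardR]; omega) ?_ ?_ hxy
    ?_ hw
  · intro p hp
    rw [Finset.mem_insert] at hp
    rcases hp with rfl | hp
    · exact hxx
    · exact fun hh => (h.disj p hp).1 (hh ▸ hx)
  · intro p hp
    rw [Finset.mem_insert] at hp
    rcases hp with rfl | hp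
    · exact hyy
    · exact fun hh => (h.disj p hp).2 (hh ▸ hy)
  · obtain ⟨r, hr, h1, h2⟩ := ht
    have : (R.filter fun r => r.1 = x ∨ r.2 = y).card < R.card :=
      Finset.card_lt_card (Finset.filter_ssubset.2 ⟨r, hr, by simp [h1, h2]⟩)
    rw [h.cardR] at this
    omega

/-- Alice may take either cell of the $2\times2$ block adjacent to `r`, leaving the opposite one to
Bob; either way `r` touches the closed cell's row or column. Both choices fail only if every other
red cell coincides with `r` or is a second red cell of the block, but `n ≥ 3` gives another red
cell. -/
theorem win_of_red (h : MatchState (n - 1) B R X Y) (hn : 3 ≤ n) (hN : N = n + 1)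
    {r : Fin N × Fin N} (hr : r ∈ R) (r1 : r.1 ∈ X) (r2 : r.2 ∈ Y) :
    Win (CellGoal 1 n N) B R := by
  obtain ⟨x', hx', hxx⟩ := h.exists_ne_fst (by omega) r.1
  obtain ⟨y', hy', hyy⟩ := h.exists_ne_snd (by omega) r.2
  have f1 : (x', r.2) ∉ R := fun hh => hxx (congrArg Prod.fst (h.red _ hh r hr hx' r2 r1 r2))
  have f2 : (r.1, y') ∉ R := fun hh => hyy (congrArg Prod.snd (h.red _ hh r hr r1 hy' r1 r2))
  by_cases t1 : ∃ s ∈ R, s.1 ≠ x' ∧ s.2 ≠ r.2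
  · exact h.win_of_touch (by omega) hN hx' r1 hxx.symm r2 hy' hyy f1 f2 t1
      (Or.inr ⟨r, hr, Or.inr rfl⟩)
  by_cases t2 : ∃ s ∈ R, s.1 ≠ r.1 ∧ s.2 ≠ y'
  · exact h.win_of_touch (by omega) hN r1 hx' hxx hy' r2 hyy.symm f2 f1 t2
      (Or.inr ⟨r, hr, Or.inl rfl⟩)
  exfalso
  push Not at t1 t2
  obtain ⟨s, hs, hsr⟩ := Finset.exists_mem_ne (by rw [h.cardR]; omega : 1 < R.card) r
  by_cases s1 : s.1 = x'
  · have s2 := t2 s hs (by rw [s1]; exact hxx)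
    exact hsr (h.red s hs r hr (s1 ▸ hx') (s2 ▸ hy') r1 r2)
  · have s2 := t1 s hs s1
    by_cases s3 : s.1 = r.1
    · exact hsr (Prod.ext s3 s2)
    · exact hyy ((t2 s hs s3).symm.trans s2)

/-- Closing in the row of `r` works for one of the two columns unless all red cells lie in that row.
In that case they do not form a matching, and closing in the other row works. -/
theorem win_of_fst (h : MatchState (n - 1) B R X Y) (hn : 3 ≤ n) (hN : N = n + 1)
    (hno : ∀ r ∈ R, r.1 ∈ X → r.2 ∉ Y) {r : Fin N × Fin N} (hr : r ∈ R) (r1 : r.1 ∈ X) :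
    Win (CellGoal 1 n N) B R := by
  obtain ⟨x', hx', hxx⟩ := h.exists_ne_fst (by omega) r.1
  obtain ⟨y, hy⟩ := Finset.card_pos.1 (by have := h.cardY; omega : 0 < Y.card)
  obtain ⟨y', hy', hyy⟩ := h.exists_ne_snd (by omega) y
  have free : ∀ a ∈ X, ∀ b ∈ Y, (a, b) ∉ R := fun a ha b hb hab => hno _ hab ha hb
  by_cases t1 : ∃ s ∈ R, s.1 ≠ r.1 ∧ s.2 ≠ y
  · exact h.win_of_touch (by omega) hN r1 hx' hxx hy hy' hyy (free _ r1 _ hy) (free _ hx' _ hy') t1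
      (Or.inr ⟨r, hr, Or.inl rfl⟩)
  by_cases t2 : ∃ s ∈ R, s.1 ≠ r.1 ∧ s.2 ≠ y'
  · exact h.win_of_touch (by omega) hN r1 hx' hxx hy' hy hyy.symm (free _ r1 _ hy')
      (free _ hx' _ hy) t2 (Or.inr ⟨r, hr, Or.inl rfl⟩)
  push Not at t1 t2
  have all : ∀ s ∈ R, s.1 = r.1 := by
    intro s hs
    by_contra hne
    exact hyy ((t2 s hs hne).symm.trans (t1 s hs hne))
  obtain ⟨s, hs, hsr⟩ := Finset.exists_mem_ne (by rw [h.cardR]; omega : 1 < R.card) r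
  refine h.win_of_touch (by omega) hN hx' r1 hxx.symm hy hy' hyy (free _ hx' _ hy)
    (free _ r1 _ hy') ⟨r, hr, hxx.symm, fun hh => hno r hr r1 (hh ▸ hy)⟩ (Or.inl fun hm => ?_)
  exact hsr (hm s hs r hr (Or.inl (all s hs)))

/-- No red cell meets the unused lines, so the wasted-edge count is unavailable. With `p = (x', y')`
as first exchange edge, Bob can cover column `y'` only by his newest edge. Rows `x` and `x'` then
both need column `y`, so he has no perfect matching. -/
theorem win_of_notMem (h : MatchState (n - 1) B R X Y) (hn : 3 ≤ n) (hN : N = n + 1)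
    (hno : ∀ r ∈ R, r.1 ∉ X ∧ r.2 ∉ Y) : Win (CellGoal 1 n N) B R := by
  obtain ⟨x, hx⟩ := Finset.card_pos.1 (by have := h.cardX; omega : 0 < X.card)
  obtain ⟨x', hx', hxx⟩ := h.exists_ne_fst (by omega) x
  obtain ⟨y, hy⟩ := Finset.card_pos.1 (by have := h.cardY; omega : 0 < Y.card)
  obtain ⟨y', hy', hyy⟩ := h.exists_ne_snd (by omega) y
  obtain ⟨q, hq⟩ := Finset.card_pos.1 (by rw [h.cardB]; omega : 0 < B.card)
  have qX : ∀ a ∈ X, q.1 ≠ a := fun a ha hh => (h.disj q hq).1 (hh ▸ ha)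
  have qY : ∀ b ∈ Y, q.2 ≠ b := fun b hb hh => (h.disj q hq).2 (hh ▸ hb)
  have row : ∀ a ∈ X, ∀ b, (a, b) ∉ R := fun a ha b hab => (hno _ hab).1 ha
  have col : ∀ a, ∀ b ∈ Y, (a, b) ∉ R := fun a b hb hab => (hno _ hab).2 hb
  refine h.win_of_close (by omega) hN hx hx' hxx hy hy' hyy (row _ hx _) (row _ hx' _) ?_
  refine win_of_doubleThreat (x := x) (y := y) (p := (x', y')) (q := q) (h.isMatch_insert hx' hy') ?_ ?_ ?_
    (Finset.mem_insert_self _ _) (Finset.mem_insert_of_mem hq)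
    (fun hh => h.notMem hx' (hh ▸ hq)) (by simp [row _ hx, hyy]) (by simp [row _ hx', hxx])
    (by simp [col _ _ hy, qX x hx]) (by simp [row _ hx, qY y hy])
    (by simp [row _ hx', hxx]) ?_
  · rw [Finset.card_insert_of_notMem (h.notMem hx'), h.cardB]; omega
  · intro p hp
    rw [Finset.mem_insert] at hp
    rcases hp with rfl | hp
    · exact hxx
    · exact fun hh => (h.disj p hp).1 (hh ▸ hx)
  · intro p hp
    rw [Finset.mem_insert] at hp
    rcases hp with rfl | hp
    · exact hyy
    · exact fun hh => (h.disj p hp).2 (hh ▸ hy)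
  · intro M hm hM e he hsub
    simp only [Finset.mem_insert, not_or] at he
    obtain ⟨s, hs, hs2⟩ := hm.exists_snd (by omega) y'
    obtain ⟨t, ht, ht1⟩ := hm.exists_fst (by omega) x
    obtain ⟨u, hu, hu1⟩ := hm.exists_fst (by omega) x'
    have hs' := hsub hs
    have ht' := hsub ht
    have hu' := hsub hu
    simp only [Finset.mem_insert] at hs' ht' hu'
    have se : s = e := by
      rcases hs' with hh | hh | hh | hh
      · exact hh
      · rw [hh] at hs2; exact absurd hs2.symm hyy
      · rw [hh] at hs2; exact absurd hs2.symm hyy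
      · exact absurd (hs2 ▸ hy') (hno s hh).2
    have te : t = (x, y) := by
      rcases ht' with hh | hh | hh | hh
      · exact absurd (Prod.ext (hh ▸ ht1) (se ▸ hs2)) he.1
      · rw [hh] at ht1; exact absurd ht1 hxx
      · exact hh
      · exact absurd (ht1 ▸ hx) (hno t hh).1
    have ue : u = (x', y) := by
      rcases hu' with hh | hh | hh | hh
      · exact absurd (Prod.ext (hh ▸ hu1) (se ▸ hs2)) he.2.1
      · exact hh
      · rw [hh] at hu1; exact absurd hu1.symm hxx
      · exact absurd (hu1 ▸ hx') (hno u hh).1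
    have := hm t ht u hu (Or.inr (by rw [te, ue]))
    rw [te, ue] at this
    exact hxx (Prod.mk.inj this).1.symm

end MatchState

theorem win_perfectMatching {n : ℕ} (hn : 3 ≤ n) : Win (CellGoal 1 n (n + 1)) ∅ ∅ := by
  refine win_of_matchState (J := n - 1) (by omega) (by omega) (by omega) fun B R X Y h => ?_
  by_cases h1 : ∃ r ∈ R, r.1 ∈ X ∧ r.2 ∈ Y
  · obtain ⟨r, hr, r1, r2⟩ := h1
    exact h.win_of_red hn rfl hr r1 r2
  push Not at h1
  by_cases h2 : ∃ r ∈ R, r.1 ∈ X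
  · obtain ⟨r, hr, r1⟩ := h2
    exact h.win_of_fst hn rfl h1 hr r1
  by_cases h3 : ∃ r ∈ R, r.2 ∈ Y
  · obtain ⟨r, hr, r2⟩ := h3
    refine Win.of_flipCells ?_
    refine h.flipCells.win_of_fst hn rfl (fun s hs s1 s2 => ?_) (r := r.swap) (by simpa using hr) r2
    exact h1 _ (mem_flipCells.1 hs) s2 s1
  push Not at h2 h3
  exact h.win_of_notMem hn rfl fun r hr => ⟨h2 r hr, h3 r hr⟩

/-! ### Large stars -/

/-- After completing the star with centre `c` and leaves `L`, Alice matches the columns `T` to rows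
in `X` without losing a move. -/
theorem win_saturate {m n N : ℕ} (hm : 3 ≤ m) (hN : m + n ≤ N) (k : ℕ) :
    ∀ (B R : Finset (Fin N × Fin N)) (c : Fin N) (L : Finset (Fin N))
      (M : Finset (Fin N × Fin N)) (X T : Finset (Fin N)),
      L.card = m → (∀ y ∈ L, (c, y) ∈ B) → M ⊆ B → M.card + (k + 1) = n → IsMatch M →
      (∀ q ∈ M, q.1 ≠ c ∧ q.2 ∉ L) → T.card = k + 1 → m + k ≤ X.card →
      (∀ x ∈ X, x ≠ c ∧ ∀ q ∈ M, q.1 ≠ x) → (∀ y ∈ T, y ∉ L ∧ ∀ q ∈ M, q.2 ≠ y) →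
      (∀ p ∈ B, p.1 ∈ X → p.2 ∉ T) → B.card = R.card → R.card + (k + 1) = m + n →
      (R.filter fun p => p.1 ∈ X ∧ p.2 ∈ T).card ≤ m →
      (∀ y ∈ T, (R.filter fun p => p.1 ∈ X ∧ p.2 = y).card < m) → Win (CellGoal m n N) B R := by
  induction k with
  | zero =>
    intro B R c L M X T hL hcL hMB hM hmatch hML hT hX hXM hTM hfree hBR hR htot hcol
    obtain ⟨y, rfl⟩ := Finset.card_eq_one.1 hT
    obtain ⟨x, hx, hxR⟩ : ∃ x ∈ X, (x, y) ∉ R := by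
      by_contra! hcon
      have := Finset.card_le_card_of_injOn (s := X) (t := R.filter fun p => p.1 ∈ X ∧ p.2 = y)
        (fun x => (x, y)) (fun x hx => by simpa [hcon x hx] using hx)
        (fun a _ b _ hab => (Prod.mk.inj hab).1)
      have := hcol y (by simp)
      omega
    have hy := hTM y (by simp)
    have hx' := hXM x hx
    have heB : (x, y) ∉ B := fun h => hfree _ h hx (by simp)
    refine .finish _ _ (x, y) heB hxR (HasLeft.cellGoal ⟨c, L, insert (x, y) M, hL,
      fun z hz => Finset.mem_insert_of_mem (hcL z hz), Finset.insert_subset_insert _ hMB, ?_,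
      hmatch.insert fun p hp => ⟨hx'.2 p hp, hy.2 p hp⟩, ?_⟩)
    · rw [Finset.card_insert_of_notMem fun h => heB (hMB h)]; omega
    · intro q hq
      rw [Finset.mem_insert] at hq
      rcases hq with rfl | hq
      · exact ⟨hx'.1, hy.1⟩
      · exact hML q hq
  | succ k ih =>
    intro B R c L M X T hL hcL hMB hM hmatch hML hT hX hXM hTM hfree hBR hR htot hcol
    obtain ⟨y, hyT, hymax⟩ := Finset.exists_max_image T
      (fun y => (R.filter fun p => p.1 ∈ X ∧ p.2 = y).card) (Finset.card_pos.1 (by omega))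
    obtain ⟨x, hx, hxR⟩ : ∃ x ∈ X, (x, y) ∉ R := by
      by_contra! hcon
      have := Finset.card_le_card_of_injOn (s := X) (t := R.filter fun p => p.1 ∈ X ∧ p.2 = y)
        (fun x => (x, y)) (fun x hx => by simpa [hcon x hx] using hx)
        (fun a _ b _ hab => (Prod.mk.inj hab).1)
      have := hcol y hyT
      omega
    have hy := hTM y hyT
    have hx' := hXM x hx
    have heB : (x, y) ∉ B := fun h => hfree _ h hx hyT
    set D := R.filter fun p => p.1 ∈ X ∧ p.2 ∈ T.erase y with hD
    set C := R.filter fun p => p.1 ∈ X ∧ p.2 = y with hC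
    have hDC : D.card + C.card ≤ m := by
      rw [← Finset.card_union_of_disjoint]
      · refine (Finset.card_le_card fun p hp => ?_).trans htot
        simp only [hD, hC, Finset.mem_union, Finset.mem_filter, Finset.mem_erase] at hp ⊢
        rcases hp with hp | hp
        · exact ⟨hp.1, hp.2.1, hp.2.2.2⟩
        · exact ⟨hp.1, hp.2.1, hp.2.2 ▸ hyT⟩
      · rw [Finset.disjoint_left]
        intro p hp hp'
        simp only [hD, hC, Finset.mem_filter, Finset.mem_erase] at hp hp'
        exact hp.2.2.1 hp'.2.2
    have hcolD : ∀ z ∈ T.erase y, (R.filter fun p => p.1 ∈ X ∧ p.2 = z).card ≤ D.card := by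
      intro z hz
      refine Finset.card_le_card fun p hp => ?_
      simp only [hD, Finset.mem_filter] at hp ⊢
      exact ⟨hp.1, hp.2.1, hp.2.2 ▸ hz⟩
    have hD0 : C.card = 0 → D.card = 0 := by
      intro h0
      rw [Finset.card_eq_zero, Finset.eq_empty_iff_forall_notMem]
      intro p hp
      simp only [hD, Finset.mem_filter] at hp
      have h1 := hymax p.2 (Finset.mem_of_mem_erase hp.2.2)
      have h2 : 0 < (R.filter fun q => q.1 ∈ X ∧ q.2 = p.2).card :=
        Finset.card_pos.2 ⟨p, by simp [hp.1, hp.2.1]⟩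
      omega
    refine Win.step (x, y) heB hxR hBR (by omega) hN fun f _ hfR => ?_
    have add : ∀ (P Q : Fin N × Fin N → Prop) [DecidablePred P] [DecidablePred Q],
        (∀ p, P p → Q p) → ((insert f R).filter P).card ≤ (R.filter Q).card + 1 := by
      intro P Q _ _ hPQ
      refine (Finset.card_le_card (t := insert f (R.filter Q)) fun p hp => ?_).trans
        (Finset.card_insert_le _ _)
      simp only [Finset.mem_filter, Finset.mem_insert] at hp ⊢
      exact hp.1.imp id fun h => ⟨h, hPQ p hp.2⟩
    refine ih (insert (x, y) B) (insert f R) c L (insert (x, y) M) (X.erase x) (T.erase y) hL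
      (fun z hz => Finset.mem_insert_of_mem (hcL z hz)) (Finset.insert_subset_insert _ hMB) ?_
      (hmatch.insert fun p hp => ⟨hx'.2 p hp, hy.2 p hp⟩) ?_ ?_ ?_ ?_ ?_ ?_ ?_ ?_ ?_ ?_
    · rw [Finset.card_insert_of_notMem fun h => heB (hMB h)]; omega
    · intro q hq
      rw [Finset.mem_insert] at hq
      rcases hq with rfl | hq
      · exact ⟨hx'.1, hy.1⟩
      · exact hML q hq
    · rw [Finset.card_erase_of_mem hyT, hT]; rfl
    · rw [Finset.card_erase_of_mem hx]; omega
    · intro z hz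
      rw [Finset.mem_erase] at hz
      refine ⟨(hXM z hz.2).1, fun q hq => ?_⟩
      rw [Finset.mem_insert] at hq
      rcases hq with rfl | hq
      · exact hz.1.symm
      · exact (hXM z hz.2).2 q hq
    · intro z hz
      rw [Finset.mem_erase] at hz
      refine ⟨(hTM z hz.2).1, fun q hq => ?_⟩
      rw [Finset.mem_insert] at hq
      rcases hq with rfl | hq
      · exact hz.1.symm
      · exact (hTM z hz.2).2 q hq
    · intro p hp p1 p2
      rw [Finset.mem_erase] at p1 p2
      rw [Finset.mem_insert] at hp
      rcases hp with rfl | hp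
      · exact p1.1 rfl
      · exact hfree p hp p1.2 p2.2
    · rw [Finset.card_insert_of_notMem heB, Finset.card_insert_of_notMem hfR, hBR]
    · rw [Finset.card_insert_of_notMem hfR]; omega
    · have := add (fun p => p.1 ∈ X.erase x ∧ p.2 ∈ T.erase y)
        (fun p => p.1 ∈ X ∧ p.2 ∈ T.erase y) fun p hp => ⟨Finset.mem_of_mem_erase hp.1, hp.2⟩
      rw [← hD] at this
      -- If column `y` held a red cell, removing it makes room for Bob's reply; if not, maximality
      -- shows that there was no red cell at all.
      omega
    · intro z hz
      have h1 := add (fun p => p.1 ∈ X.erase x ∧ p.2 = z) (fun p => p.1 ∈ X ∧ p.2 = z)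
        fun p hp => ⟨Finset.mem_of_mem_erase hp.1, hp.2⟩
      have h2 := hymax z (Finset.mem_of_mem_erase hz)
      have h3 := hcolD z hz
      -- A remaining column has at most `C.card` and at most `D.card` red cells, hence at most
      -- $m/2$; one more is still below `m` because `m ≥ 3`.
      omega

theorem exists_free_leaf {N : ℕ} {R : Finset (Fin N × Fin N)} {c : Fin N} {L : Finset (Fin N)}
    (h : L.card + (R.filter fun p => p.1 = c).card < N) : ∃ y, y ∉ L ∧ (c, y) ∉ R := by
  have h1 := Finset.card_union_le L ((R.filter fun p => p.1 = c).image Prod.snd)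
  have h2 := Finset.card_image_le (s := R.filter fun p => p.1 = c) (f := Prod.snd)
  obtain ⟨y, -, hy⟩ := Finset.exists_mem_notMem_of_card_lt_card
    (s := L ∪ (R.filter fun p => p.1 = c).image Prod.snd) (t := Finset.univ)
    (by rw [Finset.card_univ, Fintype.card_fin]; omega)
  rw [Finset.mem_union, not_or] at hy
  refine ⟨y, hy.1, fun h => hy.2 (Finset.mem_image.2 ⟨(c, y), ?_, rfl⟩)⟩
  simpa using h

/-- Alice picks the last leaf so that no other column is nearly closed. -/
theorem exists_last_leaf {N m : ℕ} (hm : 3 ≤ m)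
    {R : Finset (Fin N × Fin N)} {c : Fin N} {L : Finset (Fin N)} (hL : L.card + 1 = m)
    (hR : R.card + 1 = m) (hred : L.card + (R.filter fun p => p.1 = c).card < N) :
    ∃ y, y ∉ L ∧ (c, y) ∉ R ∧
      ∀ z ∉ insert y L, (R.filter fun p => p.1 ≠ c ∧ p.2 = z).card + 1 < m := by
  -- Bob has `m - 1` edges, so a nearly closed column contains all of them. It is then taken as the
  -- last leaf, and the other columns have no red cells.
  by_cases h : ∃ y, y ∉ L ∧ m ≤ (R.filter fun p => p.1 ≠ c ∧ p.2 = y).card + 1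
  · obtain ⟨y, hyL, hy⟩ := h
    have heq : (R.filter fun p => p.1 ≠ c ∧ p.2 = y) = R :=
      Finset.eq_of_subset_of_card_le (Finset.filter_subset _ _) (by omega)
    rw [Finset.filter_eq_self] at heq
    refine ⟨y, hyL, fun hcy => (heq _ hcy).1 rfl, fun z hz => ?_⟩
    rw [Finset.mem_insert, not_or] at hz
    rw [Finset.filter_eq_empty_iff.2 fun p hp hpz => hz.1 (hpz.2.symm.trans (heq p hp).2)]
    simp only [Finset.card_empty]
    omega
  · push Not at h
    obtain ⟨y, hyL, hyR⟩ := exists_free_leaf hred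
    exact ⟨y, hyL, hyR, fun z hz => h z fun hzL => hz (Finset.mem_insert_of_mem hzL)⟩

/-- Alice needs `i + 1` more leaves at `c` and Bob cannot close the row `c` in time. -/
theorem win_of_star {m n N : ℕ} (hm : 3 ≤ m) (hn : 1 ≤ n) (hN : m + n ≤ N)
    (c : Fin N) (i : ℕ) :
    ∀ (R : Finset (Fin N × Fin N)) (L : Finset (Fin N)), L.card + i + 1 = m →
      R.card = L.card → (R.filter fun p => p.1 = c).card + i + m ≤ N →
      Win (CellGoal m n N) ({c} ×ˢ L) R := by
  have mem : ∀ {y : Fin N} {L : Finset (Fin N)}, y ∉ L → (c, y) ∉ ({c} : Finset (Fin N)) ×ˢ L := by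
    intro y L hy h
    exact hy (Finset.mem_product.1 h).2
  have ins : ∀ (y : Fin N) (L : Finset (Fin N)),
      insert (c, y) (({c} : Finset (Fin N)) ×ˢ L) = {c} ×ˢ insert y L := by
    intro y L
    ext ⟨a, b⟩
    simp only [Finset.mem_insert, Finset.mem_product, Finset.mem_singleton, Prod.mk.injEq]
    tauto
  have hcard : ∀ L : Finset (Fin N), (({c} : Finset (Fin N)) ×ˢ L).card = L.card := by
    intro L; simp
  induction i with
  | zero =>
    intro R L hL hR hred
    obtain ⟨y, hyL, hyR, hcols⟩ := exists_last_leaf hm (R := R) (c := c) (L := L) (by omega) (by omega) (by omega)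
    refine Win.step (c, y) (mem hyL) hyR (by rw [hcard, hR]) (by omega) hN fun f _ hfR => ?_
    rw [ins]
    have hL' : (insert y L).card = m := by rw [Finset.card_insert_of_notMem hyL]; omega
    have hR' : (insert f R).card = m := by rw [Finset.card_insert_of_notMem hfR]; omega
    obtain ⟨T, hTL, hT⟩ := Finset.exists_subset_card_eq (s := (insert y L)ᶜ) (n := n)
      (by rw [Finset.card_compl, hL', Fintype.card_fin]; omega)
    have hTL' : ∀ z ∈ T, z ∉ insert y L := fun z hz => Finset.mem_compl.1 (hTL hz)
    refine win_saturate hm hN (n - 1) _ _ c (insert y L) ∅ (Finset.univ.erase c) T hL' ?_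
      (Finset.empty_subset _) (by simp; omega) (fun p hp => absurd hp (Finset.notMem_empty p))
      (fun p hp => absurd hp (Finset.notMem_empty p)) (by omega) ?_ ?_ ?_ ?_ ?_ (by omega) ?_ ?_
    · intro z hz; simpa using hz
    · rw [Finset.card_erase_of_mem (Finset.mem_univ c), Finset.card_univ, Fintype.card_fin]; omega
    · intro z hz
      exact ⟨Finset.ne_of_mem_erase hz, fun q hq => absurd hq (Finset.notMem_empty q)⟩
    · intro z hz
      exact ⟨hTL' z hz, fun q hq => absurd hq (Finset.notMem_empty q)⟩
    · intro p hp _ hpT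
      exact hTL' _ hpT (Finset.mem_product.1 hp).2
    · rw [hcard, hL', hR']
    · exact (Finset.card_filter_le _ _).trans hR'.le
    · intro z hz
      have h1 := hcols z (hTL' z hz)
      have h2 : ((insert f R).filter fun p => p.1 ∈ Finset.univ.erase c ∧ p.2 = z).card ≤
          (insert f (R.filter fun p => p.1 ≠ c ∧ p.2 = z)).card := by
        refine Finset.card_le_card fun p hp => ?_
        simp only [Finset.mem_filter, Finset.mem_insert, Finset.mem_erase, Finset.mem_univ,
          and_true] at hp ⊢
        exact hp.1.imp id fun h => ⟨h, hp.2⟩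
      have h3 := Finset.card_insert_le f (R.filter fun p => p.1 ≠ c ∧ p.2 = z)
      omega
  | succ i ih =>
    intro R L hL hR hred
    obtain ⟨y, hyL, hyR⟩ := exists_free_leaf (c := c) (R := R) (L := L) (by omega)
    refine Win.step (c, y) (mem hyL) hyR (by rw [hcard, hR]) (by omega) hN fun f _ hfR => ?_
    rw [ins]
    have hL' := Finset.card_insert_of_notMem hyL
    refine ih _ _ (by omega) (by rw [Finset.card_insert_of_notMem hfR]; omega) ?_
    have h2 : ((insert f R).filter fun p => p.1 = c).card ≤
        (insert f (R.filter fun p => p.1 = c)).card := by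
      refine Finset.card_le_card fun p hp => ?_
      simp only [Finset.mem_filter, Finset.mem_insert] at hp ⊢
      exact hp.1.imp id fun h => ⟨h, hp.2⟩
    have h3 := Finset.card_insert_le f (R.filter fun p => p.1 = c)
    omega

/-- Bob's first reply misses the row or the column of Alice's edge, and the star is built on that
line. Bob then has `m - 2` replies before the last leaf, and `N ≥ 2 * m - 2` keeps a leaf free. -/
theorem win_star {m n N : ℕ} (hm : 3 ≤ m) (hn : 1 ≤ n) (hN : m + n ≤ N) (hN2 : 2 * m ≤ N + 2) :
    Win (CellGoal m n N) ∅ ∅ := by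
  obtain ⟨c⟩ : Nonempty (Fin N) := ⟨⟨0, by omega⟩⟩
  refine Win.step (c, c) (Finset.notMem_empty _) (Finset.notMem_empty _) rfl
    (by simp; omega) hN fun f hf _ => ?_
  have key : ∀ g : Fin N × Fin N, g.1 ≠ c → Win (CellGoal m n N) {(c, c)} {g} := by
    intro g hg
    have := win_of_star hm hn hN c (m - 2) {g} {c} (by simp; omega) rfl
      (by
        rw [Finset.filter_eq_empty_iff.2 (by simpa using hg), Finset.card_empty]
        omega)
    simpa using this
  by_cases h : f.1 = c
  · refine Win.of_flipCells ?_
    have h2 : f.2 ≠ c := by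
      intro h2
      exact hf (Finset.mem_insert.2 (Or.inl (Prod.ext h h2)))
    exact key f.swap h2
  · exact key f h

/-! ### Bit masks for small boards -/

namespace BitBoard

/-- `m` is the bit mask of the set `T` of cells numbered by `pos`. -/
def Rep {ε : Type*} (pos : ε → ℕ) (m : ℕ) (T : Finset ε) : Prop :=
  ∀ k, m.testBit k = true ↔ ∃ p ∈ T, pos p = k

/-- Bit `e` of `m`, in a form that the kernel evaluates fast. -/
def bit (m e : ℕ) : Bool := Nat.ble 1 (Nat.land m (Nat.pow 2 e))

/-- Clears bit `e`. -/
def clear (e m : ℕ) : ℕ := Nat.xor m (Nat.land m (Nat.pow 2 e))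

/-- The lines after their owner has taken cell `e`. -/
def hit (e : ℕ) (A : List ℕ) : List ℕ := A.map (clear e)

/-- The lines after their opponent has taken cell `e`. -/
def kill (e : ℕ) (A : List ℕ) : List ℕ := A.filter fun l => !bit l e

theorem bit_eq_testBit (m e : ℕ) : bit m e = m.testBit e := by
  rw [Bool.eq_iff_iff, bit, Nat.ble_eq]
  change 1 ≤ m &&& 2 ^ e ↔ _
  rw [Nat.and_two_pow]
  cases m.testBit e <;> simp [Nat.one_le_two_pow]

theorem testBit_clear (e m k : ℕ) :
    (clear e m).testBit k = true ↔ m.testBit k = true ∧ k ≠ e := by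
  change (m ^^^ (m &&& 2 ^ e)).testBit k = true ↔ _
  rw [Nat.testBit_xor, Nat.testBit_and, Nat.testBit_two_pow]
  by_cases h : e = k
  · subst h; simp
  · simp [h, Ne.symm h]

section

variable {ε : Type*} {pos : ε → ℕ}

theorem Rep.testBit_iff (hpos : Function.Injective pos) {m : ℕ} {T : Finset ε} (h : Rep pos m T)
    (e : ε) : m.testBit (pos e) = true ↔ e ∈ T := by
  rw [h]
  exact ⟨fun ⟨p, hp, hpe⟩ => hpos hpe ▸ hp, fun he => ⟨e, he, rfl⟩⟩

theorem Rep.eq_zero {m : ℕ} (h : Rep pos m ∅) : m = 0 := by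
  refine Nat.eq_of_testBit_eq fun k => ?_
  have := h k
  simpa using this

theorem Rep.eq_two_pow {m : ℕ} {e : ε} (h : Rep pos m {e}) : m = 2 ^ pos e := by
  refine Nat.eq_of_testBit_eq fun k => ?_
  rw [Bool.eq_iff_iff, h k, Nat.testBit_two_pow]
  simp

theorem Rep.subset_singleton (hpos : Function.Injective pos) {e : ε} {T : Finset ε}
    (h : Rep pos (2 ^ pos e) T) : T ⊆ {e} := by
  intro p hp
  have := (h (pos p)).2 ⟨p, hp, rfl⟩
  rw [Nat.testBit_two_pow] at this
  simp only [decide_eq_true_eq] at this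
  exact Finset.mem_singleton.2 (hpos this).symm

/-- The bit mask of a list of cells. -/
def mask (pos : ε → ℕ) (l : List ε) : ℕ := l.foldr (fun p m => Nat.lor m (2 ^ pos p)) 0

theorem testBit_mask (l : List ε) (k : ℕ) :
    (mask pos l).testBit k = true ↔ ∃ p ∈ l, pos p = k := by
  induction l with
  | nil => simp [mask]
  | cons p l ih =>
    change (mask pos l ||| 2 ^ pos p).testBit k = true ↔ _
    rw [Nat.testBit_or, Bool.or_eq_true, ih, Nat.testBit_two_pow]
    simp [or_comm]

/-- `U` is the mask of the cells owned by nobody. -/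
def Free (pos : ε → ℕ) (U : ℕ) (B R : Finset ε) : Prop :=
  ∀ k, U.testBit k = true ↔ ∃ p, p ∉ B ∧ p ∉ R ∧ pos p = k

theorem Free.symm {U : ℕ} {B R : Finset ε} (h : Free pos U B R) : Free pos U R B := fun k => by
  rw [h k]
  exact ⟨fun ⟨p, h1, h2, h3⟩ => ⟨p, h2, h1, h3⟩, fun ⟨p, h1, h2, h3⟩ => ⟨p, h2, h1, h3⟩⟩

/-- Every line in the list `A` completes `P` for the owner of `B`. -/
def Sound (pos : ε → ℕ) (P : Finset ε → Prop) (A : List ℕ) (B : Finset ε) : Prop :=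
  ∀ l ∈ A, ∃ T, Rep pos l T ∧ ∀ S, B ⊆ S → T ⊆ S → P S

/-- Every way to reach `P` for the owner of `B` against `R` contains a line in the list `A`. -/
def Complete (pos : ε → ℕ) (P : Finset ε → Prop) (A : List ℕ) (B R : Finset ε) : Prop :=
  ∀ S, P S → Disjoint S R → ∃ l ∈ A, ∃ T, Rep pos l T ∧ ∀ p ∈ T, p ∈ S ∧ p ∉ B

theorem Sound.kill {P : Finset ε → Prop} {A : List ℕ} {B : Finset ε} (h : Sound pos P A B) (k : ℕ) :
    Sound pos P (kill k A) B :=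
  fun l hl => h l (List.mem_filter.1 hl).1

variable [DecidableEq ε]

theorem Rep.clear (hpos : Function.Injective pos) {m : ℕ} {T : Finset ε} (h : Rep pos m T) (e : ε) :
    Rep pos (clear (pos e) m) (T.erase e) := by
  intro k
  rw [testBit_clear, h k]
  constructor
  · rintro ⟨⟨p, hp, rfl⟩, hne⟩
    exact ⟨p, Finset.mem_erase.2 ⟨fun hh => hne (by rw [hh]), hp⟩, rfl⟩
  · rintro ⟨p, hp, rfl⟩
    rw [Finset.mem_erase] at hp
    exact ⟨⟨p, hp.2, rfl⟩, fun hh => hp.1 (hpos hh)⟩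

theorem rep_mask (l : List ε) : Rep pos (mask pos l) l.toFinset := by
  intro k
  rw [testBit_mask]
  simp

theorem Free.insert_left (hpos : Function.Injective pos) {U : ℕ} {B R : Finset ε}
    (h : Free pos U B R) (e : ε) : Free pos (BitBoard.clear (pos e) U) (insert e B) R := by
  intro k
  rw [testBit_clear, h k]
  constructor
  · rintro ⟨⟨p, hB, hR, rfl⟩, hne⟩
    exact ⟨p, by rw [Finset.mem_insert, not_or]; exact ⟨fun hh => hne (by rw [hh]), hB⟩, hR, rfl⟩
  · rintro ⟨p, hB, hR, rfl⟩
    rw [Finset.mem_insert, not_or] at hB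
    exact ⟨⟨p, hB.2, hR, rfl⟩, fun hh => hB.1 (hpos hh)⟩

theorem Free.insert_right (hpos : Function.Injective pos) {U : ℕ} {B R : Finset ε}
    (h : Free pos U B R) (e : ε) : Free pos (BitBoard.clear (pos e) U) B (insert e R) :=
  (h.symm.insert_left hpos e).symm

variable {P : Finset ε → Prop}

theorem Sound.hit (hpos : Function.Injective pos) {A : List ℕ} {B : Finset ε}
    (h : Sound pos P A B) (e : ε) : Sound pos P (hit (pos e) A) (insert e B) := by
  intro l hl
  obtain ⟨l', hl', rfl⟩ := List.mem_map.1 hl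
  obtain ⟨T, hT, hS⟩ := h l' hl'
  refine ⟨T.erase e, hT.clear hpos e, fun S hBS hTS => hS S ?_ fun p hp => ?_⟩
  · exact (Finset.subset_insert _ _).trans hBS
  · by_cases hpe : p = e
    · exact hBS (hpe ▸ Finset.mem_insert_self _ _)
    · exact hTS (Finset.mem_erase.2 ⟨hpe, hp⟩)

theorem Complete.hit (hpos : Function.Injective pos) {A : List ℕ} {B R : Finset ε}
    (h : Complete pos P A B R) (e : ε) : Complete pos P (hit (pos e) A) (insert e B) R := by
  intro S hS hd
  obtain ⟨l, hl, T, hT, hTS⟩ := h S hS hd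
  refine ⟨_, List.mem_map.2 ⟨l, hl, rfl⟩, T.erase e, hT.clear hpos e, fun p hp => ?_⟩
  rw [Finset.mem_erase] at hp
  rw [Finset.mem_insert, not_or]
  exact ⟨(hTS p hp.2).1, hp.1, (hTS p hp.2).2⟩

theorem Complete.kill (hpos : Function.Injective pos) {A : List ℕ} {B R : Finset ε}
    (h : Complete pos P A B R) (e : ε) : Complete pos P (kill (pos e) A) B (insert e R) := by
  intro S hS hd
  rw [Finset.disjoint_insert_right] at hd
  obtain ⟨l, hl, T, hT, hTS⟩ := h S hS hd.2
  refine ⟨l, List.mem_filter.2 ⟨hl, ?_⟩, T, hT, hTS⟩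
  have : ¬ l.testBit (pos e) = true := fun hh => hd.1 (hTS e ((hT.testBit_iff hpos e).1 hh)).1
  simpa [bit_eq_testBit] using this

/-! ### Verified strategies of the first player -/

/-- A strategy for the first player: `win x` takes `x` and wins; `threat e x t` takes `e`, wins at
`x` unless the opponent takes it, and goes on with `t` otherwise; `branch e t` takes `e` and goes on
with `t` after any reply; `alt s t` uses whichever of `s` and `t` works. -/
inductive Strat
  | win (x : ℕ)
  | threat (e x : ℕ) (t : Strat)
  | branch (e : ℕ) (t : Strat)
  | alt (s t : Strat)

/-- No line can be completed by a single move. -/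
def quiet (L : List ℕ) : Bool := L.all fun l => !Nat.beq l 0 && !Nat.beq l (Nat.pow 2 (Nat.log2 l))

/-- Checks a strategy on a board with `C` cells, where `U` is the mask of the free cells, `A` the
list of lines of the first player and `L` that of the opponent. -/
def check (C : ℕ) : Strat → ℕ → List ℕ → List ℕ → Bool
  | .win x, U, A, _ => bit U x && A.any fun l => Nat.beq l (Nat.pow 2 x)
  | .threat e x t, U, A, L => bit U e && (bit (clear e U) x &&
      (((hit e A).any fun l => Nat.beq l (Nat.pow 2 x)) && (quiet (kill e L) &&
        check C t (clear x (clear e U)) (kill x (hit e A)) (hit x (kill e L)))))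
  | .branch e t, U, A, L => bit U e && (!Nat.beq (clear e U) 0 && (quiet (kill e L) &&
      (List.range C).all fun f => !bit (clear e U) f ||
        check C t (clear f (clear e U)) (kill f (hit e A)) (hit f (kill e L))))
  | .alt s t, U, A, L => check C s U A L || check C t U A L

/-- A win with the single cell `f` would contain a listed line whose missing cells lie in `{f}`, so
its mask would be zero or a power of two. -/
theorem Complete.not_of_quiet {A : List ℕ} {B R : Finset ε}
    (h : Complete pos P A R B) (hq : quiet A = true) (hd : Disjoint R B) {f : ε} (hf : f ∉ B) :
    ¬ P (insert f R) := by
  intro hP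
  obtain ⟨l, hl, T, hT, hTS⟩ := h _ hP (Finset.disjoint_insert_left.2 ⟨hf, hd⟩)
  have hTf : T ⊆ {f} := fun p hp => by
    have := hTS p hp
    rw [Finset.mem_insert] at this
    exact Finset.mem_singleton.2 (this.1.resolve_right this.2)
  have hq' := List.all_eq_true.1 hq l hl
  simp only [Bool.and_eq_true, Bool.not_eq_true', ← Bool.not_eq_true, Nat.beq_eq] at hq'
  rcases Finset.subset_singleton_iff.1 hTf with rfl | rfl
  · exact hq'.1 hT.eq_zero
  · refine hq'.2 ?_
    rw [hT.eq_two_pow, Nat.log2_two_pow]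
    rfl

theorem Sound.goal (hpos : Function.Injective pos) {A : List ℕ} {B : Finset ε}
    (h : Sound pos P A B) {e : ε} (hA : (A.any fun l => Nat.beq l (Nat.pow 2 (pos e))) = true) :
    P (insert e B) := by
  obtain ⟨l, hl, hle⟩ := List.any_eq_true.1 hA
  rw [Nat.beq_eq] at hle
  subst hle
  obtain ⟨T, hT, hS⟩ := h _ hl
  exact hS _ (Finset.subset_insert _ _)
    ((hT.subset_singleton hpos).trans (by simp))

/-- Alice's list must be sound, so that claimed wins are real; Bob's must be complete, so that none
of his wins is overlooked. One subtree serves many replies because `alt` is resolved afresh in each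
position. -/
theorem win_of_check (hpos : Function.Injective pos) {C : ℕ} (hC : ∀ p, pos p < C) (s : Strat) :
    ∀ (U : ℕ) (A L : List ℕ) (B R : Finset ε), check C s U A L = true → Free pos U B R →
      Sound pos P A B → Complete pos P L R B → Disjoint R B → Win P B R := by
  induction s with
  | win x =>
    intro U A L B R hc hU hA hL hd
    simp only [check, Bool.and_eq_true, bit_eq_testBit] at hc
    obtain ⟨e, heB, heR, rfl⟩ := (hU x).1 hc.1
    exact .finish _ _ e heB heR (hA.goal hpos hc.2)
  | threat e x t ih =>
    intro U A L B R hc hU hA hL hd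
    simp only [check, Bool.and_eq_true, bit_eq_testBit] at hc
    obtain ⟨h1, h2, h3, h4, h5⟩ := hc
    obtain ⟨e, heB, heR, rfl⟩ := (hU _).1 h1
    have hU' := hU.insert_left hpos e
    obtain ⟨x, hxB, hxR, rfl⟩ := (hU' _).1 h2
    have hd' : Disjoint R (insert e B) := Finset.disjoint_insert_right.2 ⟨heR, hd⟩
    refine .round _ _ e heB heR ⟨x, hxB, hxR⟩
      (fun f hf _ => (hL.kill hpos e).not_of_quiet h4 hd' hf) fun f hf hfR => ?_
    by_cases hfx : f = x
    · subst hfx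
      exact ih _ _ _ _ _ h5 (hU'.insert_right hpos f) ((hA.hit hpos e).kill _)
        ((hL.kill hpos e).hit hpos f) (Finset.disjoint_insert_left.2 ⟨hf, hd'⟩)
    · exact .finish _ _ x hxB (by simp [hxR, Ne.symm hfx]) ((hA.hit hpos e).goal hpos h3)
  | branch e t ih =>
    intro U A L B R hc hU hA hL hd
    simp only [check, Bool.and_eq_true, bit_eq_testBit] at hc
    obtain ⟨h1, h2, h3, h4⟩ := hc
    obtain ⟨e, heB, heR, rfl⟩ := (hU _).1 h1
    have hU' := hU.insert_left hpos e
    have hd' : Disjoint R (insert e B) := Finset.disjoint_insert_right.2 ⟨heR, hd⟩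
    refine .round _ _ e heB heR ?_
      (fun f hf _ => (hL.kill hpos e).not_of_quiet h3 hd' hf) fun f hf hfR => ?_
    · have hz : clear (pos e) U ≠ 0 := fun hz => by simp [hz] at h2
      obtain ⟨k, hk⟩ := Nat.exists_testBit_of_ne_zero hz
      obtain ⟨f, h5, h6, -⟩ := (hU' k).1 hk
      exact ⟨f, h5, h6⟩
    · have h5 := List.all_eq_true.1 h4 (pos f) (List.mem_range.2 (hC f))
      have h6 : (clear (pos e) U).testBit (pos f) = true := (hU' _).2 ⟨f, hf, hfR, rfl⟩
      rw [h6] at h5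
      exact ih _ _ _ _ _ (by simpa using h5) (hU'.insert_right hpos f) ((hA.hit hpos e).kill _)
        ((hL.kill hpos e).hit hpos f) (Finset.disjoint_insert_left.2 ⟨hf, hd'⟩)
  | alt s t ihs iht =>
    intro U A L B R hc
    simp only [check, Bool.or_eq_true] at hc
    rcases hc with hc | hc
    · exact ihs U A L B R hc
    · exact iht U A L B R hc

/-! ### Verified draws of the second player -/

/-- Searches for a way of the second player to block all lines in `A` for `n` rounds. -/
def blocks (C : ℕ) : ℕ → ℕ → List ℕ → Bool
  | 0, _, _ => false
  | n + 1, U, A => (List.range C).all fun e => !bit U e ||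
      (((hit e A).all fun l => !Nat.beq l 0) && (Nat.beq (clear e U) 0 || (List.range C).any fun f =>
        bit (clear e U) f && blocks C n (clear f (clear e U)) (kill f (hit e A))))

/-- Bob only has to prevent Alice's wins, so completeness of her list suffices and his own lines
play no role. -/
theorem not_win_of_blocks (hpos : Function.Injective pos) {C : ℕ} (hC : ∀ p, pos p < C) (n : ℕ) :
    ∀ (U : ℕ) (A : List ℕ) (B R : Finset ε), blocks C n U A = true → Free pos U B R →
      Complete pos P A B R → Disjoint B R → ¬ Win P B R := by
  induction n with
  | zero => intro U A B R hb; simp [blocks] at hb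
  | succ n ih =>
    intro U A B R hb hU hA hd hW
    have key : ∀ e, e ∉ B → e ∉ R → ((hit (pos e) A).all fun l => !Nat.beq l 0) = true ∧
        (Nat.beq (clear (pos e) U) 0 || (List.range C).any fun f => bit (clear (pos e) U) f &&
          blocks C n (clear f (clear (pos e) U)) (kill f (hit (pos e) A))) = true := by
      intro e heB heR
      have h1 := List.all_eq_true.1 hb (pos e) (List.mem_range.2 (hC e))
      rw [bit_eq_testBit, (hU (pos e)).2 ⟨e, heB, heR, rfl⟩] at h1
      simpa only [Bool.not_true, Bool.false_or, Bool.and_eq_true] using h1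
    cases hW with
    | finish _ _ e heB heR hP =>
      obtain ⟨l, hl, T, hT, hTS⟩ :=
        (hA.hit hpos e) _ hP (Finset.disjoint_insert_left.2 ⟨heR, hd⟩)
      have hT0 : T = ∅ := Finset.eq_empty_of_forall_notMem fun p hp => (hTS p hp).2 (hTS p hp).1
      subst hT0
      have := List.all_eq_true.1 (key e heB heR).1 l hl
      rw [hT.eq_zero] at this
      simp at this
    | round _ _ e heB heR hne hBob hnext =>
      have hU' := hU.insert_left hpos e
      have h2 := (key e heB heR).2
      rw [Bool.or_eq_true] at h2
      rcases h2 with h2 | h2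
      · obtain ⟨f, h3, h4⟩ := hne
        have := (hU' _).2 ⟨f, h3, h4, rfl⟩
        rw [Nat.eq_of_beq_eq_true h2] at this
        simp at this
      · obtain ⟨k, -, hk⟩ := List.any_eq_true.1 h2
        rw [Bool.and_eq_true, bit_eq_testBit] at hk
        obtain ⟨f, h3, h4, rfl⟩ := (hU' k).1 hk.1
        refine ih _ _ _ _ hk.2 (hU'.insert_right hpos f) ((hA.hit hpos e).kill hpos f) ?_
          (hnext f h3 h4)
        exact Finset.disjoint_insert_right.2 ⟨h3, Finset.disjoint_insert_left.2 ⟨heR, hd⟩⟩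

/-! ### The starting positions -/

theorem sound_mask (ls : List (List ε)) (h : ∀ l ∈ ls, ∀ S : Finset ε, (∀ p ∈ l, p ∈ S) → P S) :
    Sound pos P (ls.map (mask pos)) ∅ := by
  intro m hm
  obtain ⟨l, hl, rfl⟩ := List.mem_map.1 hm
  exact ⟨_, rep_mask l, fun S _ hS => h l hl S fun p hp => hS (List.mem_toFinset.2 hp)⟩

theorem complete_mask (ls : List (List ε))
    (h : ∀ S, P S → ∃ l ∈ ls, ∀ p ∈ l, p ∈ S) :
    Complete pos P (ls.map (mask pos)) ∅ ∅ := by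
  intro S hS _
  obtain ⟨l, hl, hlS⟩ := h S hS
  exact ⟨_, List.mem_map.2 ⟨l, hl, rfl⟩, _, rep_mask l, fun p hp =>
    ⟨hlS p (List.mem_toFinset.1 hp), Finset.notMem_empty p⟩⟩

end

/-- The cells of the grid are numbered row by row. -/
def gridPos {N : ℕ} (p : Fin N × Fin N) : ℕ := N * p.1 + p.2

theorem gridPos_eq {N : ℕ} (p : Fin N × Fin N) : gridPos p = (finProdFinEquiv p : ℕ) := by
  simp [gridPos, add_comm]

theorem gridPos_injective {N : ℕ} : Function.Injective (gridPos (N := N)) := by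
  intro p q h
  rw [gridPos_eq, gridPos_eq] at h
  exact finProdFinEquiv.injective (Fin.ext h)

theorem gridPos_lt {N : ℕ} (p : Fin N × Fin N) : gridPos p < N * N := by
  rw [gridPos_eq]; exact (finProdFinEquiv p).2

theorem free_grid (N : ℕ) : Free (gridPos (N := N)) (2 ^ (N * N) - 1) ∅ ∅ := by
  intro k
  rw [Nat.testBit_two_pow_sub_one, decide_eq_true_eq]
  constructor
  · intro hk
    refine ⟨finProdFinEquiv.symm ⟨k, hk⟩, Finset.notMem_empty _, Finset.notMem_empty _, ?_⟩
    rw [gridPos_eq, Equiv.apply_symm_apply]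
  · rintro ⟨p, -, -, rfl⟩
    exact gridPos_lt p

end BitBoard

/-! ### The game of `K_{1,4} ∪ K_2` on `K_{5,5}` -/

open BitBoard

/-- The cells of a copy of `K_{1,4} ∪ K_2` in the grid of size 5: the star has centre `c` and misses
the column `o`, the other edge is `(x, o)`. -/
def starLine (c o x : Fin 5) : List (Fin 5 × Fin 5) :=
  (x, o) :: ((List.finRange 5).filter fun j => j != o).map fun j => (c, j)

/-- All copies of `K_{1,4} ∪ K_2` in the grid of size 5. -/
def starLines : List (List (Fin 5 × Fin 5)) :=
  (List.finRange 5).flatMap fun c => (List.finRange 5).flatMap fun o =>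
    ((List.finRange 5).filter fun x => x != c).flatMap fun x =>
      [starLine c o x, (starLine c o x).map Prod.swap]

theorem mem_starLines {l : List (Fin 5 × Fin 5)} :
    l ∈ starLines ↔ ∃ c o x : Fin 5, x ≠ c ∧
      (l = starLine c o x ∨ l = (starLine c o x).map Prod.swap) := by
  simp [starLines]

theorem mem_starLine {c o x : Fin 5} {p : Fin 5 × Fin 5} :
    p ∈ starLine c o x ↔ p = (x, o) ∨ (p.1 = c ∧ p.2 ≠ o) := by
  obtain ⟨a, b⟩ := p
  simp only [starLine, List.mem_cons, List.mem_map, List.mem_filter, List.mem_finRange, true_and,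
    bne_iff_ne, ne_eq, Prod.mk.injEq]
  constructor
  · rintro (h | ⟨j, h1, rfl, rfl⟩)
    · exact Or.inl h
    · exact Or.inr ⟨rfl, h1⟩
  · rintro (h | ⟨rfl, h⟩)
    · exact Or.inl h
    · exact Or.inr ⟨b, h, rfl, rfl⟩

theorem hasLeft_of_starLine {S : Finset (Fin 5 × Fin 5)} {c o x : Fin 5} (hx : x ≠ c)
    (h : ∀ p ∈ starLine c o x, p ∈ S) : HasLeft 4 1 S := by
  refine ⟨c, Finset.univ.erase o, {(x, o)}, by simp, fun y hy => ?_, ?_, by simp, ?_, ?_⟩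
  · exact h _ (mem_starLine.2 (Or.inr ⟨rfl, Finset.ne_of_mem_erase hy⟩))
  · exact Finset.singleton_subset_iff.2 (h _ (mem_starLine.2 (Or.inl rfl)))
  · intro p hp q hq _
    rw [Finset.mem_singleton.1 hp, Finset.mem_singleton.1 hq]
  · intro q hq
    rw [Finset.mem_singleton.1 hq]
    exact ⟨hx, by simp⟩

theorem HasLeft.exists_starLine {S : Finset (Fin 5 × Fin 5)} (h : HasLeft 4 1 S) :
    ∃ c o x : Fin 5, x ≠ c ∧ ∀ p ∈ starLine c o x, p ∈ S := by
  obtain ⟨c, L, M, hL, hcL, hMS, hM, -, hML⟩ := h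
  obtain ⟨⟨x, o⟩, rfl⟩ := Finset.card_eq_one.1 hM
  have hxo := hML (x, o) (by simp)
  have hLo : L = Finset.univ.erase o := by
    refine Finset.eq_of_subset_of_card_le (fun y hy => ?_) (by simp [hL])
    exact Finset.mem_erase.2 ⟨fun hh => hxo.2 (hh ▸ hy), Finset.mem_univ y⟩
  refine ⟨c, o, x, hxo.1, fun p hp => ?_⟩
  rcases mem_starLine.1 hp with rfl | ⟨h1, h2⟩
  · exact hMS (by simp)
  · have := hcL p.2 (by rw [hLo]; simp [h2])
    rwa [← h1] at this

theorem sound_starLines (l : List (Fin 5 × Fin 5)) (hl : l ∈ starLines)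
    (S : Finset (Fin 5 × Fin 5)) (hS : ∀ p ∈ l, p ∈ S) : CellGoal 4 1 5 S := by
  obtain ⟨c, o, x, hx, rfl | rfl⟩ := mem_starLines.1 hl
  · exact (hasLeft_of_starLine hx hS).cellGoal
  · rw [← CellGoal.flipCells_iff]
    refine (hasLeft_of_starLine (c := c) (o := o) hx fun p hp => ?_).cellGoal
    exact mem_flipCells.2 (hS _ (List.mem_map_of_mem hp))

theorem complete_starLines (S : Finset (Fin 5 × Fin 5)) (h : CellGoal 4 1 5 S) :
    ∃ l ∈ starLines, ∀ p ∈ l, p ∈ S := by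
  rcases cellGoal_iff.1 h with h | h
  · obtain ⟨c, o, x, hx, hS⟩ := h.exists_starLine
    exact ⟨_, mem_starLines.2 ⟨c, o, x, hx, Or.inl rfl⟩, hS⟩
  · obtain ⟨c, o, x, hx, hS⟩ := h.exists_starLine
    refine ⟨_, mem_starLines.2 ⟨c, o, x, hx, Or.inr rfl⟩, fun p hp => ?_⟩
    obtain ⟨q, hq, rfl⟩ := List.mem_map.1 hp
    exact mem_flipCells.1 (hS q hq)

/-- Alice's strategy on the grid of size 5 once she owns the cells 0, 5 and Bob the cells 1, 10. -/
def starStrat : Strat :=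
    .branch 15 (.alt (.threat 20 11 (.win 12)) (.alt (.threat 20 13 (.win 14)) ( .branch 6 (.alt (
    .branch 7 (.alt (.threat 9 3 (.win 13)) (.alt (.threat 3 9 (.threat 8 14 (.win 19))) (.alt
    (.threat 4 8 (.threat 9 13 (.win 18))) (.threat 8 4 (.win 14)))))) (.alt ( .branch 8 (.alt
    (.threat 9 2 (.win 12)) (.alt (.threat 2 9 (.threat 7 14 (.win 19))) (.alt (.threat 4 7
    (.threat 9 12 (.win 17))) (.threat 7 4 (.win 14)))))) (.alt ( .branch 9 (.alt (.threat 8 2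
    (.win 12)) (.alt (.threat 2 8 (.threat 7 13 (.win 18))) (.alt (.threat 3 7 (.threat 8 12 (.win
    17))) (.threat 7 3 (.win 13)))))) (.alt ( .branch 8 (.alt (.threat 9 12 (.win 17)) (.alt
    (.threat 9 2 (.win 22)) ( .branch 18 (.alt (.threat 13 23 (.threat 3 21 (.win 22))) (.alt
    (.threat 17 19 (.threat 16 4 (.win 14))) (.threat 19 17 (.threat 16 2 (.win 12))))))))) (.alt
    ( .branch 7 (.alt (.threat 9 3 (.win 13)) (.alt (.threat 9 18 (.win 23)) ( .branch 17 (.alt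
    (.threat 18 19 (.threat 16 4 (.win 14))) (.alt (.threat 12 22 (.threat 2 21 (.win 23)))
    (.threat 19 18 (.threat 16 3 (.win 13))))))))) (.alt ( .branch 7 (.alt (.threat 8 4 (.win 14))
    (.alt (.threat 8 19 (.win 24)) ( .branch 17 (.alt (.threat 18 19 (.threat 16 4 (.win 14)))
    (.alt (.threat 12 22 (.threat 2 21 (.win 23))) (.threat 19 18 (.threat 16 3 (.win 13)))))))))
    (.alt ( .branch 7 (.alt (.threat 8 4 (.win 14)) (.alt (.threat 9 3 (.win 13)) (.alt (.threat
    14 8 (.threat 9 3 (.win 18))) (.threat 13 9 (.threat 8 4 (.win 19))))))) (.alt ( .branch 8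
    (.alt (.threat 7 4 (.win 14)) (.alt (.threat 9 2 (.win 12)) (.alt (.threat 14 7 (.threat 9 2
    (.win 17))) (.threat 12 9 (.threat 7 4 (.win 19))))))) (.alt ( .branch 9 (.alt (.threat 7 3
    (.win 13)) (.alt (.threat 8 2 (.win 12)) (.alt (.threat 13 7 (.threat 8 2 (.win 17))) (.threat
    12 8 (.threat 7 3 (.win 18))))))) (.alt ( .branch 7 (.alt (.threat 8 4 (.win 24)) (.alt
    (.threat 9 3 (.win 13)) (.alt (.threat 24 8 (.threat 9 3 (.win 13))) (.threat 23 9 (.threat 8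
    4 (.win 14))))))) (.alt ( .branch 8 (.alt (.threat 7 4 (.win 24)) (.alt (.threat 9 2 (.win
    12)) (.alt (.threat 24 7 (.threat 9 2 (.win 12))) (.threat 22 9 (.threat 7 4 (.win 14))))))) (
    .branch 9 (.alt (.threat 7 3 (.win 23)) (.alt (.threat 8 2 (.win 12)) (.alt (.threat 23 7
    (.threat 8 2 (.win 12))) (.threat 22 8 (.threat 7 3 (.win 13)))))))))))))))))))))

/-- The masks of all copies of `K_{1,4} ∪ K_2`. -/
def starMasks : List ℕ := starLines.map (mask gridPos)

-- The masks follow the four moves made: a player's own cell shortens his lines, and the opponent's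
-- cell deletes the lines through it.
set_option maxRecDepth 100000 in
theorem check_starStrat : check 25 starStrat
    (clear 10 (clear 5 (clear 1 (clear 0 (2 ^ (5 * 5) - 1)))))
    (kill 10 (hit 5 (kill 1 (hit 0 starMasks))))
    (hit 10 (kill 5 (hit 1 (kill 0 starMasks)))) = true := by
  decide +kernel

theorem win_starPosition :
    Win (CellGoal 4 1 5) (flipCells {(0, 0), (1, 0)}) (flipCells {(0, 1), (2, 0)}) := by
  refine Win.of_flipCells ?_
  rw [flipCells_flipCells, flipCells_flipCells]
  have hpos := gridPos_injective (N := 5)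
  have hS := sound_mask (pos := gridPos) starLines sound_starLines
  have hC := complete_mask (pos := gridPos) starLines complete_starLines
  have hU := free_grid 5
  refine win_of_check hpos gridPos_lt starStrat _ _ _ {(0, 0), (1, 0)} {(0, 1), (2, 0)}
    check_starStrat ?_ ?_ ?_ (by decide)
  · have := (((hU.insert_left hpos (0, 0)).insert_right hpos (0, 1)).insert_left hpos
      (1, 0)).insert_right hpos (2, 0)
    rw [Finset.pair_comm, Finset.pair_comm (0, 1)]
    exact this
  · have := (((hS.hit hpos (0, 0)).kill 1).hit hpos (1, 0)).kill 10
    rw [Finset.pair_comm]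
    exact this
  · have := (((hC.kill hpos (0, 0)).hit hpos (0, 1)).kill hpos (1, 0)).hit hpos (2, 0)
    rw [Finset.pair_comm, Finset.pair_comm (0, 0)]
    exact this

theorem exists_perm_three (f : Fin 3 → Fin 5) (hf : Function.Injective f) :
    ∃ τ : Equiv.Perm (Fin 5), τ 0 = f 0 ∧ τ 1 = f 1 ∧ τ 2 = f 2 := by
  let g : Fin 3 ↪ Fin 5 := ⟨Fin.castLE (by omega), Fin.castLE_injective _⟩
  have := Equiv.Perm.isMultiplyPretransitive (Fin 5) 3
  obtain ⟨τ, hτ⟩ := MulAction.exists_smul_eq (Equiv.Perm (Fin 5)) g ⟨f, hf⟩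
  refine ⟨τ, ?_, ?_, ?_⟩
  · exact DFunLike.congr_fun hτ 0
  · exact DFunLike.congr_fun hτ 1
  · exact DFunLike.congr_fun hτ 2

/-- Permutations of rows and of columns carry the computed position to every position of this shape.
-/
theorem win_star_four_one_aux {c i z z' p : Fin 5} (hi : i ≠ c) (hz : z ≠ z') (hpz : p ≠ z)
    (hpz' : p ≠ z') :
    Win (CellGoal 4 1 5) {(c, z), (c, z')} {(i, z), (c, p)} := by
  obtain ⟨ρ, hρ0, hρ1, -⟩ : ∃ ρ : Equiv.Perm (Fin 5), ρ 0 = c ∧ ρ 1 = i ∧ True := by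
    -- Only two rows matter; `j` fills the third slot of `exists_perm_three`.
    obtain ⟨j, hj⟩ : ∃ j : Fin 5, j ∉ ({c, i} : Finset (Fin 5)) := by
      by_contra! h
      have h1 := Finset.card_le_card (fun x _ => h x : Finset.univ ⊆ ({c, i} : Finset (Fin 5)))
      have h2 := Finset.card_le_two (a := c) (b := i)
      simp only [Finset.card_univ, Fintype.card_fin] at h1
      omega
    simp only [Finset.mem_insert, Finset.mem_singleton, not_or] at hj
    obtain ⟨ρ, h0, h1, -⟩ := exists_perm_three ![c, i, j] (by
      intro a b hab
      fin_cases a <;> fin_cases b <;> simp_all [eq_comm])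
    exact ⟨ρ, h0, h1, trivial⟩
  obtain ⟨τ, hτ0, hτ1, hτ2⟩ := exists_perm_three ![z, z', p] (by
      intro a b hab
      fin_cases a <;> fin_cases b <;> simp_all [eq_comm])
  have := win_starPosition.map (Equiv.prodCongr ρ τ) (CellGoal.prodCongr ρ τ)
  simpa [flipCells, Finset.map_insert, hρ0, hρ1, hτ0, hτ1, hτ2] using this

/-- `win_star` would need size 6. If Bob's second reply misses row `c`, the tempo argument
`win_of_star` still works; if it lies in row `c`, the position is the computed one up to symmetry.
-/
theorem win_star_four_one : Win (CellGoal 4 1 5) ∅ ∅ := by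
  let c : Fin 5 := 0
  refine Win.step (c, c) (Finset.notMem_empty _) (Finset.notMem_empty _) rfl
    (by simp) le_rfl fun f hf _ => ?_
  have key : ∀ g : Fin 5 × Fin 5, g.1 ≠ c → Win (CellGoal 4 1 5) {(c, c)} {g} := by
    rintro ⟨i, z⟩ hi
    replace hi : i ≠ c := hi
    -- The second leaf is chosen so that Bob's first edge lies in a column of one of Alice's two
    -- leaves, which leaves a single type of position.
    obtain ⟨a, hac, hza⟩ : ∃ a, a ≠ c ∧ (z = a ∨ z = c) := by
      by_cases hz : z = c
      · obtain ⟨a, ha⟩ := exists_ne c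
        exact ⟨a, ha, Or.inr hz⟩
      · exact ⟨z, hz, Or.inl rfl⟩
    refine Win.step (c, a) (by simp [hac]) (by simp [hi.symm]) rfl (by simp) le_rfl
      fun f hf hfR => ?_
    by_cases hfc : f.1 = c
    · obtain ⟨b, p⟩ := f
      replace hfc : b = c := hfc
      subst hfc
      simp only [Finset.mem_insert, Finset.mem_singleton, Prod.mk.injEq, true_and, not_or] at hf
      rw [Finset.pair_comm _ (i, z)]
      rcases hza with rfl | rfl
      · exact win_star_four_one_aux hi hac hf.1 hf.2
      · rw [Finset.pair_comm]
        exact win_star_four_one_aux hi hac.symm hf.2 hf.1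
    · have := win_of_star (m := 4) (n := 1) (N := 5) (by omega) le_rfl le_rfl c 1
        (insert f {(i, z)}) {a, c} (by rw [Finset.card_pair hac])
        (by rw [Finset.card_pair hac, Finset.card_insert_of_notMem hfR, Finset.card_singleton]) (by
          rw [Finset.filter_eq_empty_iff.2 (by simp [hfc, hi])]
          simp)
      convert this using 1
      ext ⟨u, v⟩
      simp only [Finset.mem_insert, Finset.mem_singleton, Finset.mem_product, Prod.mk.injEq]
      tauto
  by_cases h : f.1 = c
  · refine Win.of_flipCells ?_
    have h2 : f.2 ≠ c := by
      intro h2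
      exact hf (Finset.mem_insert.2 (Or.inl (Prod.ext h h2)))
    exact key f.swap h2
  · exact key f h

/-! ### Draws of the perfect matching game on the two smallest boards -/

/-- The perfect matchings of the grid. -/
def permLines (N : ℕ) : List (List (Fin N × Fin N)) :=
  (List.finRange N).permutations'.map fun l => (List.finRange N).zip l

theorem complete_permLines {n : ℕ} (S : Finset (Fin (n + 1) × Fin (n + 1)))
    (h : CellGoal 1 n (n + 1) S) : ∃ l ∈ permLines (n + 1), ∀ p ∈ l, p ∈ S := by
  obtain ⟨M, hMS, hM, hm⟩ := cellGoal_one_iff.1 h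
  have hex := fun x => hm.exists_fst hM x
  choose s hs hsx using hex
  have hinj : Function.Injective fun x => (s x).2 := fun a b hab => by
    have := hm _ (hs a) _ (hs b) (Or.inr hab)
    rw [← hsx a, ← hsx b, this]
  let σ : Equiv.Perm (Fin (n + 1)) := Equiv.ofBijective _ (Finite.injective_iff_bijective.1 hinj)
  refine ⟨_, List.mem_map.2 ⟨(List.finRange (n + 1)).map σ,
    List.mem_permutations'.2 (Equiv.Perm.map_finRange_perm σ), rfl⟩, fun p hp => ?_⟩
  have hz : (List.finRange (n + 1)).zip ((List.finRange (n + 1)).map σ) =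
      (List.finRange (n + 1)).map fun x => (x, σ x) := by
    have := List.zip_map' (f := id) (g := σ) (l := List.finRange (n + 1))
    simpa using this
  rw [hz] at hp
  obtain ⟨x, -, rfl⟩ := List.mem_map.1 hp
  have : (x, σ x) = s x := Prod.ext (hsx x).symm rfl
  rw [this]
  exact hMS (hs x)

theorem not_win_of_blocks_permLines {n k : ℕ}
    (h : blocks ((n + 1) * (n + 1)) k (2 ^ ((n + 1) * (n + 1)) - 1)
      ((permLines (n + 1)).map (mask gridPos)) = true) : ¬ Win (CellGoal 1 n (n + 1)) ∅ ∅ :=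
  not_win_of_blocks gridPos_injective gridPos_lt k _ _ _ _ h (free_grid _)
    (complete_mask _ complete_permLines) (Finset.disjoint_empty_left _)

/-- Four cells last two rounds; the third level is needed to recognise the full board, as `blocks`
fails at depth 0. -/
theorem not_win_two : ¬ Win (CellGoal 1 1 2) ∅ ∅ :=
  not_win_of_blocks_permLines (k := 3) (by decide +kernel)

theorem not_win_three : ¬ Win (CellGoal 1 2 3) ∅ ∅ :=
  not_win_of_blocks_permLines (k := 5) (by decide +kernel)

theorem win_single_edge : Win (CellGoal 1 0 1) ∅ ∅ :=
  .finish _ _ (0, 0) (Finset.notMem_empty _) (Finset.notMem_empty _)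
    (cellGoal_one_iff.2 ⟨_, subset_rfl, rfl, fun p hp q hq _ => by
      rw [Finset.mem_insert] at hp hq
      simp at hp hq
      rw [hp, hq]⟩)

/-! ### Assembling the three parts of the theorem -/

theorem isBipartiteAchievementNumber_of_win {m n k : ℕ} (h : Win (CellGoal m n k) ∅ ∅)
    (hk : ∀ N, Win (CellGoal m n N) ∅ ∅ → k ≤ N) :
    IsBipartiteAchievementNumber (starMatching m n) k :=
  ⟨aliceHasWinningStrategy_iff.2 h, fun N hN => hk N (aliceHasWinningStrategy_iff.1 hN)⟩

theorem mainTheorem7 :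
    (∀ n : ℕ,
      IsBipartiteAchievementNumber (starMatching 1 n) (if n = 1 ∨ n = 2 then n + 2 else n + 1)) ∧
    (∀ m n : ℕ, 2 ≤ m → 1 ≤ n → (m ≤ 4 ∨ m ≤ n + 2) →
      IsBipartiteAchievementNumber (starMatching m n) (m + n)) ∧
    (∀ m n : ℕ, 5 ≤ m → 1 ≤ n → n + 3 ≤ m →
      ∃ k : ℕ, IsBipartiteAchievementNumber (starMatching m n) k ∧
        m + n ≤ k ∧ k ≤ 2 * m - 2) := by
  refine ⟨fun n => ?_, fun m n hm hn hmn => ?_, fun m n hm hn hmn => ?_⟩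
  · split_ifs with h
    · refine isBipartiteAchievementNumber_of_win (win_matching n) fun N hN => ?_
      have h1 := hN.le_size
      by_contra hlt
      obtain rfl : N = n + 1 := by omega
      rcases h with rfl | rfl
      · exact not_win_two hN
      · exact not_win_three hN
    · refine isBipartiteAchievementNumber_of_win ?_ fun N hN => by have := hN.le_size; omega
      by_cases h0 : n = 0
      · subst h0
        exact win_single_edge
      · exact win_perfectMatching (by omega)
  · refine isBipartiteAchievementNumber_of_win ?_ fun N hN => hN.le_size
    by_cases h2 : m = 2
    · subst h2
      rw [add_comm 2 n]
      exact win_two n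
    -- This is the size condition of `win_star` on the board of size `m + n`; with `m ≥ 3` it fails
    -- only for `m = 4`, `n = 1`.
    · by_cases h3 : 2 * m ≤ m + n + 2
      · exact win_star (by omega) hn le_rfl h3
      · obtain rfl : m = 4 := by omega
        obtain rfl : n = 1 := by omega
        exact win_star_four_one
  · have hwin : ∃ N, Win (CellGoal m n N) ∅ ∅ :=
      ⟨2 * m - 2, win_star (by omega) hn (by omega) (by omega)⟩
    classical
    refine ⟨Nat.find hwin, isBipartiteAchievementNumber_of_win (Nat.find_spec hwin)
      fun N hN => Nat.find_min' hwin hN, (Nat.find_spec hwin).le_size, ?_⟩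
    exact Nat.find_min' hwin (win_star (by omega) hn (by omega) (by omega))
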